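/- Consider an M/M/1 queue with first-in-first-out service, with customers indexed by $k\in\mathbb Z$: customer $k$ arrives at time $A_k$ and has service time $\sigma_k$; the inter-arrival times $\tau_k=A_{k+1}-A_k$ are $\mathrm{Exp}(\lambda)$, the service times $\sigma_k$ are $\mathrm{Exp}(\mu)$, all the variables $\tau_k,\sigma_k$ are independent, and $0<\lambda<\mu$. The queue is in equilibrium, i.e. customer $k$ departs at time $D_k=\sup_{m\le k}(A_m+\sigma_m+\dots+\sigma_k)$, and the queue length at time $t$ is $Q_t=\#\{k: A_k\le t<D_k\}$. A busy period is a maximal time interval during which $Q_t>0$, and its length is the number of customers served during it. Let $n\ge 0$, and let $\mathcal D_n$ be the set of Dyck paths of length $2n$, i.e. of lattice paths from $(0,0)$ to $(2n,0)$ with steps $(1,1)$ and $(1,-1)$ that never go below the horizontal axis; its cardinality is the Catalan number $C_n=\frac1{n+1}\binom{2n}{n}$. For $\pi\in\mathcal D_n$ and $0\le i\le n-1$ let $\alpha_i(\pi)$ be the length of the intersection of $\pi$ with the line $y=x-2i$, measured in diagonal steps (the number of steps of $\pi$ contained in the line; equivalently, $\alpha_i(\pi)+1$ is the number of lattice points common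 to $\pi$ and the line). Put $$P_n(y_0,\dots,y_{n-1})=\sum_{\pi\in\mathcal D_n}\ \prod_{i=0}^{n-1}\frac{y_i^{\alpha_i(\pi)}}{\alpha_i(\pi)!}.$$ Then, for every $k\in\mathbb Z$, the event that customer $k$ is the first customer of a busy period of length $n+1$ has positive probability, and conditionally on this event the vector $(\sigma_k,\dots,\sigma_{k+n})$ of the service times of the successive customers of the busy period has the density (with respect to Lebesgue measure on $\mathbb R^{n+1}$) $$D(y_0,\dots,y_n)=\frac{(\lambda+\mu)^{2n+1}}{C_n}\,e^{-(\lambda+\mu)(y_0+\dots+y_{n-1})}\,P_n(y_0,\dots,y_{n-1})\,e^{-(\lambda+\mu)y_n}$$ for $y_0,\dots,y_n\ge 0$, and $D=0$ elsewhere. -/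

import Mathlib

open MeasureTheory ProbabilityTheory

noncomputable section

namespace MM1

/-! ### The single-server first-in-first-out queue in equilibrium

A realisation of the input is a pair of sequences `A σ : ℤ → ℝ`: customer `k` arrives at time `A k`
and requires the service time `σ k`. -/

/-- Departure time of customer `n` in equilibrium. It is the smallest solution of the recursion
`D n = max (A n) (D (n - 1)) + σ n`, given by `D n = sup_{m ≤ n} (A m + σ m + ⋯ + σ n)`. -/
def departure (A σ : ℤ → ℝ) (n : ℤ) : ℝ :=
  ⨆ m : Set.Iic n, (A m + ∑ j ∈ Finset.Icc (m : ℤ) n, σ j)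

/-- First-in-first-out recursion: the service of customer `n` starts when he has arrived and
customer `n - 1` has left, whichever is later, and lasts `σ n`. -/
theorem departure_eq_max_add (A σ : ℤ → ℝ) (n : ℤ)
    (h : BddAbove (Set.range fun m : Set.Iic (n - 1) =>
      A m + ∑ j ∈ Finset.Icc (m : ℤ) (n - 1), σ j)) :
    departure A σ n = max (A n) (departure A σ (n - 1)) + σ n := by
  have hsum : ∀ m : ℤ, m ≤ n - 1 →
      ∑ j ∈ Finset.Icc m n, σ j = ∑ j ∈ Finset.Icc m (n - 1), σ j + σ n := by
    intro m hm
    have : Finset.Icc m n = insert n (Finset.Icc m (n - 1)) := by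
      ext x; simp only [Finset.mem_insert, Finset.mem_Icc]; omega
    rw [this, Finset.sum_insert (by simp), add_comm]
  have hle : ∀ m : Set.Iic n, A m + ∑ j ∈ Finset.Icc (m : ℤ) n, σ j ≤
      max (A n) (departure A σ (n - 1)) + σ n := by
    rintro ⟨m, hm⟩
    rcases eq_or_lt_of_le (show m ≤ n from hm) with rfl | hlt
    · simp
    · have hm' : m ≤ n - 1 := by omega
      have h1 := le_ciSup h ⟨m, hm'⟩
      have h2 := le_max_right (A n) (departure A σ (n - 1))
      simp only [hsum m hm']
      simp only [departure] at h2 ⊢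
      linarith
  have hbdd : BddAbove (Set.range fun m : Set.Iic n =>
      A m + ∑ j ∈ Finset.Icc (m : ℤ) n, σ j) := by
    refine ⟨max (A n) (departure A σ (n - 1)) + σ n, ?_⟩
    rintro _ ⟨m, rfl⟩
    exact hle m
  have : Nonempty (Set.Iic n) := ⟨⟨n, Set.self_mem_Iic⟩⟩
  have : Nonempty (Set.Iic (n - 1)) := ⟨⟨n - 1, Set.self_mem_Iic⟩⟩
  refine le_antisymm (ciSup_le hle) ?_
  rw [← max_add_add_right]
  refine max_le ?_ ?_
  · have := le_ciSup hbdd ⟨n, le_refl n⟩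
    simpa [departure] using this
  · rw [← le_sub_iff_add_le]
    refine ciSup_le ?_
    rintro ⟨m, hm⟩
    have hm' : m ≤ n - 1 := hm
    have h1 := le_ciSup hbdd ⟨m, show m ≤ n by omega⟩
    simp only [hsum m hm'] at h1
    simp only [departure] at h1 ⊢
    linarith

/-- Queue length `Q_t`: the number of customers in service or in the buffer at time `t`. -/
def queueLength (A σ : ℤ → ℝ) (t : ℝ) : ℕ∞ :=
  {k : ℤ | A k ≤ t ∧ t < departure A σ k}.encard

/-- A busy period is a maximal (nonempty) time interval during which the queue is non-empty. -/
def IsBusyPeriod (A σ : ℤ → ℝ) (B : Set ℝ) : Prop :=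
  Maximal (fun I : Set ℝ => I.Nonempty ∧ I.OrdConnected ∧ ∀ t ∈ I, 0 < queueLength A σ t) B

/-- The length of a busy period `B` is the number of customers served during `B`; customer `k` is
in service during `[D k - σ k, D k)`. -/
def busyLength (A σ : ℤ → ℝ) (B : Set ℝ) : ℕ∞ :=
  {k : ℤ | Set.Ico (departure A σ k - σ k) (departure A σ k) ⊆ B}.encard

/-- Customer `k` is the first customer of a busy period that consists of `N` customers. -/
def OpensBusyPeriod (A σ : ℤ → ℝ) (k : ℤ) (N : ℕ) : Prop :=
  ∃ B : Set ℝ, IsBusyPeriod A σ B ∧ IsLeast B (A k) ∧ busyLength A σ B = N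

/-! ### Dyck polynomials -/

/-- Ordinate of the Dyck path after `i` steps (`U` is the step `(1, 1)` and `D` the step
`(1, -1)`). -/
def height (p : DyckWord) (i : ℕ) : ℤ :=
  (p.toList.take i).count DyckStep.U - (p.toList.take i).count DyckStep.D

/-- Length of the intersection of the Dyck path with the line `y = x - 2 j`, one diagonal step
being the unit of length: the number of steps of the path both endpoints of which lie on the
line. -/
def alpha (p : DyckWord) (j : ℕ) : ℕ :=
  ((Finset.range p.toList.length).filter fun i =>
    height p i = (i : ℤ) - 2 * j ∧ height p (i + 1) = ((i + 1 : ℕ) : ℤ) - 2 * j).card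

/-- The Dyck polynomial `P_n`, a sum over all Dyck paths of length `2 n`. -/
def dyckPoly (n : ℕ) (y : Fin n → ℝ) : ℝ :=
  ∑ p : {p : DyckWord // p.semilength = n},
    ∏ i : Fin n, y i ^ alpha p.1 i / (Nat.factorial (alpha p.1 i) : ℝ)

/-- The density `D(y_0, …, y_n)`, which is zero off the nonnegative orthant. -/
def serviceDensity (lam mu : ℝ) (n : ℕ) : (Fin (n + 1) → ℝ) → ℝ :=
  Set.indicator {y | ∀ i, 0 ≤ y i} fun y =>
    (lam + mu) ^ (2 * n + 1) / (catalan n : ℝ)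
      * Real.exp (-(lam + mu) * ∑ i : Fin n, y i.castSucc)
      * dyckPoly n (fun i => y i.castSucc)
      * Real.exp (-(lam + mu) * y (Fin.last n))

end MM1

end

/-! Customer `k` opens a busy period when `D_{k-1} < A_k`, an event that depends only on the `σ_j,
τ_j` with `j < k`. Given this, the period has `n + 1` customers exactly when the partial sums of
`τ_k, τ_{k+1}, …` stay below those of `σ_k, σ_{k+1}, …` (ties allowed) through index `n - 1` and
exceed them at index `n` (`ServesExactly`). This second condition is independent of the past, so
conditioning on the opening contributes only a constant factor.

It remains to find the probability of `ServesExactly` for fixed services `y`. Heuristically, `α_i`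
Poisson arrivals fall in the `i`-th service, and the admissible sequences of counts are the
up-blocks of Dyck paths, with no arrival during the last service; this suggests `λ^n e^{-λ ∑ y}
P_n(y)`. The proof (`pi_expMeasure_servesExactly`) conditions on the first inter-arrival time `a ≤
y_0`: the rest of the first service merges with the second one, which gives `P_{n+1}(x, s_0, s_1, …)
= ∫_0^x P_n(u + s_0, s_1, …) du`. Dyck polynomials satisfy this identity (`integral_excursionSum`),
by the binomial theorem applied to the first block.

Multiplying by the `Exp(μ)` densities gives a multiple of `D`. Each Dyck path contributes to `D` a
product of Gamma densities with weight `1/C_n`, so `D` has mass one (`lintegral_serviceDensity`) and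
is the conditional density. The strong law makes the suprema finite almost surely, and an
independence argument shows that customers find an empty queue with positive probability. -/

namespace MM1

/-! ### Dyck words as sequences of blocks -/

/-- The number of up-steps of `w` that are preceded by exactly `j` down-steps. -/
def blockCount (w : List DyckStep) (j : ℕ) : ℕ :=
  ((Finset.range w.length).filter fun i =>
    (w.take i).count DyckStep.D = j ∧ (w.take (i + 1)).count DyckStep.D = j).card

theorem blockCount_cons (s : DyckStep) (w : List DyckStep) (j : ℕ) :
    blockCount (s :: w) j =
      ((Finset.range w.length).filter fun i => (s :: w.take i).count DyckStep.D = j ∧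
        (s :: w.take (i + 1)).count DyckStep.D = j).card +
      if 0 = j ∧ [s].count DyckStep.D = j then 1 else 0 := by
  rw [blockCount, Finset.card_filter, List.length_cons, Finset.sum_range_succ', Finset.card_filter]
  rfl

theorem blockCount_U_cons_zero (w : List DyckStep) :
    blockCount (DyckStep.U :: w) 0 = blockCount w 0 + 1 := by
  rw [blockCount_cons]; simp [blockCount]

theorem blockCount_U_cons_succ (w : List DyckStep) (j : ℕ) :
    blockCount (DyckStep.U :: w) (j + 1) = blockCount w (j + 1) := by
  rw [blockCount_cons]; simp [blockCount]

theorem blockCount_D_cons_zero (w : List DyckStep) :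
    blockCount (DyckStep.D :: w) 0 = 0 := by
  rw [blockCount_cons]; simp

theorem blockCount_D_cons_succ (w : List DyckStep) (j : ℕ) :
    blockCount (DyckStep.D :: w) (j + 1) = blockCount w j := by
  rw [blockCount_cons]; simp [blockCount]

/-- Removing the first block of up-steps and the down-step that closes it shifts all later block
indices by one; the recursions below rest on this. -/
theorem blockCount_replicate_append_zero (a : ℕ) (w : List DyckStep) :
    blockCount (List.replicate a DyckStep.U ++ DyckStep.D :: w) 0 = a := by
  induction a with
  | zero => simp [blockCount_D_cons_zero]
  | succ a ih => simp [List.replicate_succ, blockCount_U_cons_zero, ih]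

theorem blockCount_replicate_append_succ (a : ℕ) (w : List DyckStep) (j : ℕ) :
    blockCount (List.replicate a DyckStep.U ++ DyckStep.D :: w) (j + 1) = blockCount w j := by
  induction a with
  | zero => simp [blockCount_D_cons_succ]
  | succ a ih => simp [List.replicate_succ, blockCount_U_cons_succ, ih]

theorem count_U_add_count_D (w : List DyckStep) :
    w.count DyckStep.U + w.count DyckStep.D = w.length := by
  induction w with
  | nil => rfl
  | cons s w ih => cases s <;> simp <;> omega

/-- After `i` steps, `d` of them down, the height is `i - 2 d`, so the path is on the line `y = x -
2 j` exactly when `d = j`. -/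
theorem alpha_eq_blockCount (p : DyckWord) (j : ℕ) : alpha p j = blockCount p.toList j := by
  unfold alpha blockCount
  congr 1
  refine Finset.filter_congr fun i hi => ?_
  have hi := Finset.mem_range.1 hi
  have h1 := count_U_add_count_D (p.toList.take i)
  have h2 := count_U_add_count_D (p.toList.take (i + 1))
  rw [List.length_take, min_eq_left (by omega)] at h1 h2
  unfold height
  constructor <;> rintro ⟨h3, h4⟩ <;> constructor <;> omega

/-! ### Nonnegative paths ending at height zero, enumerated by their blocks -/

/-- `w` leads from height `h` to height `0` without going below `0`. -/
def IsExcursion : ℕ → List DyckStep → Prop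
  | h, [] => h = 0
  | h, DyckStep.U :: w => IsExcursion (h + 1) w
  | h, DyckStep.D :: w => 1 ≤ h ∧ IsExcursion (h - 1) w

theorem isExcursion_iff (w : List DyckStep) (h : ℕ) :
    IsExcursion h w ↔ h + w.count DyckStep.U = w.count DyckStep.D ∧
      ∀ i, (w.take i).count DyckStep.D ≤ h + (w.take i).count DyckStep.U := by
  induction w generalizing h with
  | nil => simp [IsExcursion]
  | cons s w ih =>
    cases s
    · rw [IsExcursion, ih]
      simp only [List.count_cons]
      refine and_congr (by simp; omega) ⟨fun H i => ?_, fun H i => ?_⟩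
      · cases i with
        | zero => simp
        | succ i => have := H i; simp; omega
      · have := H (i + 1); simp at this; omega
    · rw [IsExcursion, ih]
      simp only [List.count_cons]
      constructor
      · rintro ⟨h1, h2, H⟩
        refine ⟨by simp; omega, fun i => ?_⟩
        cases i with
        | zero => simp
        | succ i => have := H i; simp; omega
      · rintro ⟨h2, H⟩
        have h1 := H 1
        simp at h1 h2
        refine ⟨h1, by omega, fun i => ?_⟩
        have := H (i + 1); simp at this; omega

theorem isExcursion_replicate_append (a h : ℕ) (w : List DyckStep) :
    IsExcursion h (List.replicate a DyckStep.U ++ w) ↔ IsExcursion (h + a) w := by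
  induction a generalizing h with
  | zero => simp
  | succ a ih =>
    simp only [List.replicate_succ, List.cons_append, IsExcursion, ih]
    rw [show h + 1 + a = h + (a + 1) by omega]

theorem IsExcursion.le_count {w : List DyckStep} {h : ℕ} (hw : IsExcursion h w) :
    h ≤ w.count DyckStep.D := by
  have := ((isExcursion_iff w h).1 hw).1
  omega

/-- Words with `n` down-steps that lead from height `h` to `0` without going below `0`, listed by
their blocks of consecutive up-steps. -/
def excursions : ℕ → ℕ → Finset (List DyckStep)
  | 0, h => if h = 0 then {[]} else ∅
  -- At most `n + 1` up-steps can come first: the height `h + a - 1` after the block must be undone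
  -- by the `n` remaining down-steps.
  | n + 1, h => (Finset.range (n + 2)).biUnion fun a =>
      if 1 ≤ h + a then
        (excursions n (h + a - 1)).image fun w => List.replicate a DyckStep.U ++ DyckStep.D :: w
      else ∅

theorem exists_eq_replicate_append {w : List DyckStep} (hw : 1 ≤ w.count DyckStep.D) :
    ∃ a w', w = List.replicate a DyckStep.U ++ DyckStep.D :: w' := by
  induction w with
  | nil => simp at hw
  | cons s w ih =>
    cases s
    · obtain ⟨a, w', rfl⟩ := ih (by simpa [List.count_cons] using hw)
      exact ⟨a + 1, w', by simp [List.replicate_succ]⟩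
    · exact ⟨0, w, by simp⟩

theorem mem_excursions (n h : ℕ) (w : List DyckStep) :
    w ∈ excursions n h ↔ IsExcursion h w ∧ w.count DyckStep.D = n := by
  induction n generalizing h w with
  | zero =>
    rw [excursions]
    constructor
    · split_ifs with hh
      · intro hw
        obtain rfl : w = [] := by simpa using hw
        simp [IsExcursion, hh]
      · simp
    · rintro ⟨hw, h0⟩
      have h1 := ((isExcursion_iff w h).1 hw).1
      have h2 := count_U_add_count_D w
      obtain rfl : w = [] := List.length_eq_zero_iff.1 (by omega)
      rw [if_pos (show h = 0 from hw)]; simp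
  | succ n ih =>
    rw [excursions, Finset.mem_biUnion]
    constructor
    · rintro ⟨a, -, hw⟩
      split_ifs at hw with hha
      · obtain ⟨w', hw', rfl⟩ := Finset.mem_image.1 hw
        obtain ⟨h1, h2⟩ := (ih _ _).1 hw'
        refine ⟨(isExcursion_replicate_append _ _ _).2 ⟨hha, h1⟩, ?_⟩
        simp [List.count_replicate, h2]
      · simp at hw
    · rintro ⟨h1, h2⟩
      obtain ⟨a, w', rfl⟩ := exists_eq_replicate_append (w := w) (by omega)
      obtain ⟨h3, h4⟩ := (isExcursion_replicate_append _ _ _).1 h1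
      have h5 := h4.le_count
      have h6 : w'.count DyckStep.D = n := by simpa [List.count_replicate] using h2
      refine ⟨a, Finset.mem_range.2 (by omega), ?_⟩
      rw [if_pos h3]
      exact Finset.mem_image.2 ⟨w', (ih _ _).2 ⟨h4, h6⟩, rfl⟩

/-! ### Generating function of the blocks and its integral recursion -/

/-- The generating function of `excursions n h` by block sizes, divided by factorials. -/
noncomputable def excursionSum : ℕ → ℕ → (ℕ → ℝ) → ℝ
  | 0, h, _ => if h = 0 then 1 else 0
  | n + 1, h, s => ∑ a ∈ Finset.range (n + 2),
      if 1 ≤ h + a then s 0 ^ a / (a.factorial : ℝ) * excursionSum n (h + a - 1) fun j => s (j + 1)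
      else 0

theorem sum_excursions (n h : ℕ) (s : ℕ → ℝ) :
    ∑ w ∈ excursions n h, ∏ i ∈ Finset.range n,
      s i ^ blockCount w i / ((blockCount w i).factorial : ℝ) = excursionSum n h s := by
  induction n generalizing h s with
  | zero => rw [excursions, excursionSum]; split_ifs <;> simp
  | succ n ih =>
    rw [excursions, excursionSum, Finset.sum_biUnion]
    · refine Finset.sum_congr rfl fun a _ => ?_
      split_ifs with hha
      · rw [Finset.sum_image, ← ih, Finset.mul_sum]
        · refine Finset.sum_congr rfl fun w _ => ?_
          rw [Finset.prod_range_succ', mul_comm]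
          simp only [blockCount_replicate_append_zero, blockCount_replicate_append_succ]
        · intro w _ w' _ hww
          simpa using hww
      · simp
    -- The union is disjoint because a word determines the size of its first block.
    · intro a _ b _ hab
      rw [Function.onFun, Finset.disjoint_left]
      intro w hwa hwb
      split_ifs at hwa hwb <;> simp only [Finset.mem_image, Finset.notMem_empty] at hwa hwb
      obtain ⟨w1, -, rfl⟩ := hwa
      obtain ⟨w2, -, h2⟩ := hwb
      have := congrArg (blockCount · 0) h2
      simp only [blockCount_replicate_append_zero] at this
      exact hab this.symm

/-- Counts the up-steps; for Dyck paths it fixes the total degree that produces the exponent `2 n +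
1` of `lam + mu`. -/
theorem sum_blockCount {n h : ℕ} {w : List DyckStep} (hw : w ∈ excursions n h) :
    h + ∑ i ∈ Finset.range n, blockCount w i = n := by
  induction n generalizing h w with
  | zero => rw [excursions] at hw; split_ifs at hw with hh <;> simp_all
  | succ n ih =>
    obtain ⟨a, -, hw⟩ := Finset.mem_biUnion.1 (by rwa [excursions] at hw)
    split_ifs at hw with hha
    · obtain ⟨w', hw', rfl⟩ := Finset.mem_image.1 hw
      have := ih hw'
      rw [Finset.sum_range_succ']
      simp only [blockCount_replicate_append_zero, blockCount_replicate_append_succ]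
      omega
    · simp at hw

theorem toList_mem_excursions {n : ℕ} {p : DyckWord} (hp : p.semilength = n) :
    p.toList ∈ excursions n 0 := by
  refine (mem_excursions _ _ _).2 ⟨(isExcursion_iff _ _).2 ⟨?_, fun i => ?_⟩, ?_⟩
  · rw [zero_add]; exact p.count_U_eq_count_D
  · rw [zero_add]; exact p.count_D_le_count_U i
  · rw [← DyckWord.semilength_eq_count_D]; exact hp

theorem sum_alpha {n : ℕ} {p : DyckWord} (hp : p.semilength = n) :
    ∑ i : Fin n, alpha p i = n := by
  have := sum_blockCount (toList_mem_excursions hp)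
  rw [zero_add] at this
  rw [Fin.sum_univ_eq_sum_range (fun i => alpha p i) n]
  simpa only [alpha_eq_blockCount] using this

theorem dyckPoly_eq_excursionSum (n : ℕ) (s : ℕ → ℝ) :
    dyckPoly n (fun i => s i) = excursionSum n 0 s := by
  rw [← sum_excursions, dyckPoly]
  refine Finset.sum_bij (fun p _ => p.1.toList) ?_ ?_ ?_ ?_
  · intro p _
    exact toList_mem_excursions p.2
  · intro p _ q _ hpq
    exact Subtype.ext (DyckWord.ext hpq)
  · intro w hw
    obtain ⟨h1, h2⟩ := (mem_excursions _ _ _).1 hw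
    obtain ⟨h3, h4⟩ := (isExcursion_iff _ _).1 h1
    simp only [zero_add] at h3 h4
    exact ⟨⟨⟨w, h3, h4⟩, h3.trans h2⟩, Finset.mem_univ _, rfl⟩
  · intro p _
    simp only [alpha_eq_blockCount]
    exact Fin.prod_univ_eq_prod_range
      (fun i => s i ^ blockCount p.1.toList i / ((blockCount p.1.toList i).factorial : ℝ)) n

/-- Prepend a real number to a sequence. -/
def consSeq (x : ℝ) (s : ℕ → ℝ) : ℕ → ℝ := fun j => Nat.casesOn j x s

theorem excursionSum_of_lt {n h : ℕ} (hn : n < h) (s : ℕ → ℝ) : excursionSum n h s = 0 := by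
  induction n generalizing h s with
  | zero => simp [excursionSum]; omega
  | succ n ih =>
    rw [excursionSum]
    refine Finset.sum_eq_zero fun a _ => ?_
    rw [if_pos (by omega), ih (by omega), mul_zero]

theorem excursionSum_zero_consSeq (n : ℕ) (x : ℝ) (s : ℕ → ℝ) :
    excursionSum (n + 1) 0 (consSeq x s) =
      ∑ b ∈ Finset.range (n + 1), x ^ (b + 1) / ((b + 1).factorial : ℝ) * excursionSum n b s := by
  rw [excursionSum, Finset.sum_range_succ']
  simp [consSeq]

/-- The divided power `(x + s 0) ^ m / m!` splits the first block into `b` steps of weight `x` and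
`m - b` of weight `s 0`. The former may be regarded as a starting height `b`. -/
theorem excursionSum_consSeq_add (n : ℕ) (x : ℝ) (s : ℕ → ℝ) :
    excursionSum (n + 1) 0 (consSeq (x + s 0) fun j => s (j + 1)) =
      ∑ b ∈ Finset.range (n + 2), x ^ b / (b.factorial : ℝ) * excursionSum (n + 1) b s := by
  have hbin : ∀ m : ℕ, (x + s 0) ^ m / (m.factorial : ℝ) = ∑ k ∈ Finset.range (m + 1),
      x ^ k / (k.factorial : ℝ) * (s 0 ^ (m - k) / ((m - k).factorial : ℝ)) := by
    intro m
    rw [add_pow, Finset.sum_div]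
    refine Finset.sum_congr rfl fun k hk => ?_
    rw [Nat.cast_choose ℝ (Nat.lt_succ_iff.1 (Finset.mem_range.1 hk))]
    have := Nat.factorial_ne_zero m
    field_simp
  let f : ℕ → ℕ → ℝ := fun b a => if 1 ≤ b + a then
    x ^ b / (b.factorial : ℝ) * (s 0 ^ a / (a.factorial : ℝ) *
      excursionSum n (b + a - 1) fun j => s (j + 1)) else 0
  have hl : excursionSum (n + 1) 0 (consSeq (x + s 0) fun j => s (j + 1)) =
      ∑ m ∈ Finset.range (n + 2), ∑ k ∈ Finset.range (m + 1), f k (m - k) := by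
    rw [excursionSum]
    refine Finset.sum_congr rfl fun m _ => ?_
    rw [zero_add]
    split_ifs with hm
    · rw [show consSeq (x + s 0) (fun j => s (j + 1)) 0 = x + s 0 from rfl, hbin, Finset.sum_mul]
      refine Finset.sum_congr rfl fun k hk => ?_
      have hk := Finset.mem_range.1 hk
      simp only [f]
      rw [if_pos (by omega), show k + (m - k) = m by omega, mul_assoc]
      rfl
    · refine (Finset.sum_eq_zero fun k hk => ?_).symm
      have hk := Finset.mem_range.1 hk
      exact if_neg (by omega)
  rw [hl, Finset.sum_range_diag_flip]
  refine Finset.sum_congr rfl fun b hb => ?_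
  have hb := Finset.mem_range.1 hb
  rw [excursionSum, Finset.mul_sum]
  -- The additional terms have `b + a - 1 > n` and vanish, as `n` down-steps cannot reach zero from
  -- there.
  refine (Finset.sum_subset (Finset.range_mono (Nat.sub_le _ _)) fun a _ ha => ?_).trans
    (Finset.sum_congr rfl fun a _ => ?_)
  · rw [Finset.mem_range] at ha
    simp only [f]
    rw [if_pos (by omega), excursionSum_of_lt (by omega)]
    simp
  · simp only [f, mul_ite, mul_zero]

/-- The first variable enters only through divided powers, and differentiation lowers each by one:
one up-step of the first block is removed. -/
theorem hasDerivAt_excursionSum (n : ℕ) (x : ℝ) (s : ℕ → ℝ) :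
    HasDerivAt (fun x => excursionSum (n + 1) 0 (consSeq x s))
      (∑ b ∈ Finset.range (n + 1), x ^ b / (b.factorial : ℝ) * excursionSum n b s) x := by
  simp only [excursionSum_zero_consSeq]
  refine HasDerivAt.fun_sum fun b _ => HasDerivAt.mul_const ?_ _
  convert! (hasDerivAt_pow (b + 1) x).div_const ((b + 1).factorial : ℝ) using 1
  rw [Nat.factorial_succ]
  have := Nat.factorial_ne_zero b
  push_cast
  field_simp

theorem continuous_excursionSum_consSeq (n : ℕ) (s : ℕ → ℝ) :
    Continuous fun x => excursionSum n 0 (consSeq x s) := by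
  cases n with
  | zero => exact continuous_const
  | succ n => exact continuous_iff_continuousAt.2 fun x =>
      (hasDerivAt_excursionSum n x s).continuousAt

/-- The two expansions above agree: the derivative in the first variable is the polynomial of lower
order with its first two variables added. This is the recursion obtained by conditioning on the
first arrival. -/
theorem integral_excursionSum (n : ℕ) (x : ℝ) (s : ℕ → ℝ) :
    ∫ u in (0 : ℝ)..x, excursionSum n 0 (consSeq (u + s 0) fun j => s (j + 1)) =
      excursionSum (n + 1) 0 (consSeq x s) := by
  rw [intervalIntegral.integral_eq_sub_of_hasDerivAt
    (f := fun x => excursionSum (n + 1) 0 (consSeq x s))]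
  · simp [excursionSum_zero_consSeq]
  · intro u _
    convert! hasDerivAt_excursionSum n u s using 1
    cases n with
    | zero => simp [excursionSum]
    | succ n => exact excursionSum_consSeq_add n u s
  · exact ((continuous_excursionSum_consSeq n _).comp
      (continuous_add_const (s 0))).intervalIntegrable _ _

theorem excursionSum_nonneg (n h : ℕ) {s : ℕ → ℝ} (hs : ∀ j, 0 ≤ s j) :
    0 ≤ excursionSum n h s := by
  rw [← sum_excursions]
  exact Finset.sum_nonneg fun w _ => Finset.prod_nonneg fun i _ =>
    div_nonneg (pow_nonneg (hs i) _) (Nat.cast_nonneg _)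

/-! ### Busy periods of a realisation -/

theorem queueLength_pos_iff {A σ : ℤ → ℝ} {t : ℝ} :
    0 < queueLength A σ t ↔ ∃ j, A j ≤ t ∧ t < departure A σ j := by
  rw [queueLength, Set.encard_pos]
  rfl

/-- The union of two intersecting busy intervals is again a busy interval, so maximality absorbs it.
-/
theorem IsBusyPeriod.subset_of_inter_nonempty {A σ : ℤ → ℝ} {B I : Set ℝ}
    (hB : IsBusyPeriod A σ B) (hI : I.OrdConnected) (hbusy : ∀ t ∈ I, 0 < queueLength A σ t)
    (hne : (B ∩ I).Nonempty) : I ⊆ B := by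
  obtain ⟨⟨hB1, hB2, hB3⟩, hmax⟩ := hB
  have hU : (B ∪ I).OrdConnected :=
    (hB2.isPreconnected.union' hne hI.isPreconnected).ordConnected
  exact Set.subset_union_right.trans (hmax ⟨hB1.mono Set.subset_union_left, hU, fun t ht =>
    ht.elim (hB3 t) (hbusy t)⟩ Set.subset_union_left)

theorem queueLength_pos_of_mem_Ico {A σ : ℤ → ℝ} {k : ℤ} {n : ℕ}
    (hstep : ∀ i < n, A (k + i + 1) ≤ departure A σ (k + i)) {t : ℝ}
    (ht : t ∈ Set.Ico (A k) (departure A σ (k + n))) : 0 < queueLength A σ t := by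
  induction n with
  | zero => exact queueLength_pos_iff.2 ⟨k, by simpa using ht⟩
  | succ n ih =>
    by_cases hlt : t < departure A σ (k + n)
    · exact ih (fun i hi => hstep i (by omega)) ⟨ht.1, hlt⟩
    · refine queueLength_pos_iff.2 ⟨k + (n + 1 : ℕ), ?_, ht.2⟩
      have := hstep n (by omega)
      push_cast
      rw [← add_assoc]
      linarith

theorem arrival_eq_add_sum (A : ℤ → ℝ) (k : ℤ) (n : ℕ) :
    A (k + n + 1) = A k + ∑ i ∈ Finset.range (n + 1), (A (k + i + 1) - A (k + i)) := by
  induction n with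
  | zero => simp
  | succ n ih =>
    rw [Finset.sum_range_succ, ← add_assoc, ← ih]
    push_cast
    rw [← add_assoc]
    ring

/-- A realisation with increasing arrival times, positive service times and finite departure
times. -/
structure IsRegular (A σ : ℤ → ℝ) : Prop where
  lt_succ : ∀ j, A j < A (j + 1)
  pos : ∀ j, 0 < σ j
  bddAbove : ∀ n : ℤ, BddAbove (Set.range fun m : Set.Iic n =>
    A m + ∑ j ∈ Finset.Icc (m : ℤ) n, σ j)

namespace IsRegular

variable {A σ : ℤ → ℝ}

theorem departure_eq (h : IsRegular A σ) (n : ℤ) :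
    departure A σ n = max (A n) (departure A σ (n - 1)) + σ n :=
  departure_eq_max_add A σ n (h.bddAbove _)

theorem strictMono_arrival (h : IsRegular A σ) : StrictMono A := strictMono_int_of_lt_succ h.lt_succ

theorem strictMono_departure (h : IsRegular A σ) : StrictMono (departure A σ) := by
  refine strictMono_int_of_lt_succ fun n => ?_
  rw [h.departure_eq (n + 1), add_sub_cancel_right]
  have := h.pos (n + 1)
  have := le_max_right (A (n + 1)) (departure A σ n)
  linarith

theorem lt_departure (h : IsRegular A σ) (n : ℤ) : A n < departure A σ n := by
  rw [h.departure_eq n]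
  have := h.pos n
  have := le_max_left (A n) (departure A σ (n - 1))
  linarith

theorem isBusyPeriod_Ico (h : IsRegular A σ) {k : ℤ} {n : ℕ} (hfirst : departure A σ (k - 1) < A k)
    (hstep : ∀ i < n, A (k + i + 1) ≤ departure A σ (k + i))
    (hlast : departure A σ (k + n) < A (k + n + 1)) :
    IsBusyPeriod A σ (Set.Ico (A k) (departure A σ (k + n))) := by
  have hlt : A k < departure A σ (k + n) :=
    (h.lt_departure k).trans_le (h.strictMono_departure.monotone (by omega))
  refine ⟨⟨Set.nonempty_Ico.2 hlt, Set.ordConnected_Ico, fun t => queueLength_pos_of_mem_Ico hstep⟩,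
    ?_⟩
  rintro I ⟨-, hI, hbusy⟩ hsub t ht
  have hkI : A k ∈ I := hsub ⟨le_rfl, hlt⟩
  constructor
  · by_contra! hlt'
    -- The server is idle on `[D_{k-1}, A_k)`; an interval reaching further left would contain such
    -- an instant.
    have hs : max t (departure A σ (k - 1)) ∈ I :=
      hI.out ht hkI ⟨le_max_left _ _, max_le hlt'.le hfirst.le⟩
    obtain ⟨j, hj1, hj2⟩ := queueLength_pos_iff.1 (hbusy _ hs)
    have hjk : j < k := h.strictMono_arrival.lt_iff_lt.1 (hj1.trans_lt (max_lt hlt' hfirst))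
    have h1 := h.strictMono_departure.monotone (show j ≤ k - 1 by omega)
    have h2 := le_max_right t (departure A σ (k - 1))
    linarith
  · by_contra! hle
    -- At the instant `D_{k+n}` the queue is empty, since the next arrival is strictly later.
    have hs : departure A σ (k + n) ∈ I := hI.out hkI ht ⟨hlt.le, hle⟩
    obtain ⟨j, hj1, hj2⟩ := queueLength_pos_iff.1 (hbusy _ hs)
    have hjk := h.strictMono_departure.lt_iff_lt.1 hj2
    have h1 := h.strictMono_arrival.monotone (show k + n + 1 ≤ j by omega)
    linarith

theorem busyLength_Ico (h : IsRegular A σ) {k : ℤ} {n : ℕ} (hfirst : departure A σ (k - 1) < A k) :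
    busyLength A σ (Set.Ico (A k) (departure A σ (k + n))) = (n + 1 : ℕ) := by
  have hset : {j : ℤ | Set.Ico (departure A σ j - σ j) (departure A σ j) ⊆
      Set.Ico (A k) (departure A σ (k + n))} = (Finset.Icc k (k + n) : Finset ℤ) := by
    ext j
    rw [Set.mem_ofPred_eq, Set.Ico_subset_Ico_iff (by linarith [h.pos j]),
      h.strictMono_departure.le_iff_le, h.departure_eq j, add_sub_cancel_right, le_max_iff]
    rw [Finset.mem_coe, Finset.mem_Icc]
    refine and_congr_left fun _ => ⟨fun hj => ?_, fun hj => Or.inl (h.strictMono_arrival.monotone hj)⟩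
    by_contra! hjk
    rcases hj with hj | hj
    · exact absurd (h.strictMono_arrival hjk) (not_lt.2 hj)
    · have := h.strictMono_departure.monotone (show j - 1 ≤ k - 1 by omega)
      linarith
  rw [busyLength, hset, Set.encard_coe_eq_coe_finsetCard, Int.card_Icc]
  congr 1
  omega

theorem opensBusyPeriod_iff (h : IsRegular A σ) (k : ℤ) (n : ℕ) :
    OpensBusyPeriod A σ k (n + 1) ↔ departure A σ (k - 1) < A k ∧
      (∀ i < n, A (k + i + 1) ≤ departure A σ (k + i)) ∧
      departure A σ (k + n) < A (k + n + 1) := by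
  constructor
  · rintro ⟨B, hB, hleast, hlen⟩
    have hfirst : departure A σ (k - 1) < A k := by
      by_contra! hle
      have hsub := hB.subset_of_inter_nonempty (I := Set.Icc (A (k - 1)) (A k))
        Set.ordConnected_Icc (fun t ht => ?_)
        ⟨A k, hleast.1, (h.strictMono_arrival (by omega)).le, le_rfl⟩
      · have h1 : A (k - 1) < A k := h.strictMono_arrival (by omega)
        exact absurd (hleast.2 (hsub ⟨le_rfl, h1.le⟩)) (not_le.2 h1)
      · rcases ht.2.eq_or_lt with rfl | hlt
        · exact queueLength_pos_iff.2 ⟨k, le_rfl, h.lt_departure k⟩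
        · exact queueLength_pos_iff.2 ⟨k - 1, ht.1, by linarith⟩
    -- If the server never became idle, `B` would contain the services of customers `k, …, k + n +
    -- 1`, one too many.
    have hfail : ∃ m : ℕ, departure A σ (k + m) < A (k + m + 1) := by
      by_contra! hall
      have hsub : ∀ m : ℕ, Set.Ico (A k) (departure A σ (k + m)) ⊆ B := fun m =>
        hB.subset_of_inter_nonempty Set.ordConnected_Ico
          (fun t => queueLength_pos_of_mem_Ico fun i _ => hall i)
          ⟨A k, hleast.1, le_rfl,
            (h.lt_departure k).trans_le (h.strictMono_departure.monotone (by omega))⟩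
      have hle : ((n + 1 + 1 : ℕ) : ℕ∞) ≤ busyLength A σ B := by
        rw [← h.busyLength_Ico (n := n + 1) hfirst]
        exact Set.encard_le_encard fun j hj => Set.Subset.trans hj (hsub (n + 1))
      rw [hlen] at hle
      norm_cast at hle
      omega
    classical
    have hm := Nat.find_spec hfail
    have hmin : ∀ i < Nat.find hfail, A (k + i + 1) ≤ departure A σ (k + i) := fun i hi =>
      not_lt.1 (Nat.find_min hfail hi)
    generalize Nat.find hfail = m at hm hmin
    have hI := h.isBusyPeriod_Ico hfirst hmin hm
    have hkI : A k ∈ Set.Ico (A k) (departure A σ (k + m)) :=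
      ⟨le_rfl, (h.lt_departure k).trans_le (h.strictMono_departure.monotone (by omega))⟩
    have hBI : B = Set.Ico (A k) (departure A σ (k + m)) := Set.Subset.antisymm
      (hI.subset_of_inter_nonempty hB.1.2.1 hB.1.2.2 ⟨A k, hkI, hleast.1⟩)
      (hB.subset_of_inter_nonempty hI.1.2.1 hI.1.2.2 ⟨A k, hleast.1, hkI⟩)
    rw [hBI, h.busyLength_Ico hfirst] at hlen
    norm_cast at hlen
    obtain rfl : m = n := by omega
    exact ⟨hfirst, hmin, hm⟩
  · rintro ⟨hfirst, hstep, hlast⟩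
    exact ⟨_, h.isBusyPeriod_Ico hfirst hstep hlast, ⟨⟨le_rfl, (h.lt_departure k).trans_le
      (h.strictMono_departure.monotone (by omega))⟩, fun t ht => ht.1⟩, h.busyLength_Ico hfirst⟩

/-- Up to the end of the busy period opened by customer `k` the server works without pause. -/
theorem departure_eq_of_busy (h : IsRegular A σ) {k : ℤ} {n : ℕ} (hfirst : departure A σ (k - 1) < A k)
    (hstep : ∀ i < n, A (k + i + 1) ≤ departure A σ (k + i)) :
    departure A σ (k + n) = A k + ∑ i ∈ Finset.range (n + 1), σ (k + i) := by
  induction n with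
  | zero => simp [h.departure_eq k, max_eq_left hfirst.le]
  | succ n ih =>
    have ih := ih fun i hi => hstep i (by omega)
    have hn := hstep n (by omega)
    rw [Finset.sum_range_succ, ← add_assoc, ← ih, h.departure_eq]
    push_cast
    rw [show k + ((n : ℤ) + 1) - 1 = k + n by ring, ← add_assoc, max_eq_right hn]

theorem opensBusyPeriod_iff_sum (h : IsRegular A σ) (k : ℤ) (n : ℕ) :
    OpensBusyPeriod A σ k (n + 1) ↔ departure A σ (k - 1) < A k ∧
      (∀ i < n, ∑ j ∈ Finset.range (i + 1), (A (k + j + 1) - A (k + j)) ≤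
        ∑ j ∈ Finset.range (i + 1), σ (k + j)) ∧
      ∑ j ∈ Finset.range (n + 1), σ (k + j) <
        ∑ j ∈ Finset.range (n + 1), (A (k + j + 1) - A (k + j)) := by
  rw [h.opensBusyPeriod_iff]
  refine and_congr_right fun hfirst => ?_
  have key : ∀ i : ℕ, (∀ j < i, A (k + j + 1) ≤ departure A σ (k + j)) →
      departure A σ (k + i) = A (k + i + 1) + (∑ j ∈ Finset.range (i + 1), σ (k + j) -
        ∑ j ∈ Finset.range (i + 1), (A (k + j + 1) - A (k + j))) := by
    intro i hi
    rw [h.departure_eq_of_busy hfirst hi, arrival_eq_add_sum A k i]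
    ring
  constructor
  · rintro ⟨hstep, hlast⟩
    refine ⟨fun i hi => ?_, ?_⟩
    · have h1 := key i fun j hj => hstep j (by omega)
      have h2 := hstep i hi
      linarith
    · have h1 := key n hstep
      linarith
  · rintro ⟨hstep, hlast⟩
    -- Strong induction: the formula for `D_{k+i}` holds only once the server is known to be busy up
    -- to then.
    have hstep' : ∀ i < n, A (k + i + 1) ≤ departure A σ (k + i) := by
      intro i
      induction i using Nat.strong_induction_on with
      | _ i ih =>
        intro hi
        have h1 := key i fun j hj => ih j hj (by omega)
        have h2 := hstep i hi
        linarith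
    have h1 := key n hstep'
    exact ⟨hstep', by linarith⟩

end IsRegular

/-! ### The interarrival times during a busy period -/

/-- The interarrival times `t` keep a server with service times `y`, who starts with one customer,
busy for exactly `n + 1` services. -/
def ServesExactly (n : ℕ) (y t : ℕ → ℝ) : Prop :=
  (∀ i < n, ∑ j ∈ Finset.range (i + 1), t j ≤ ∑ j ∈ Finset.range (i + 1), y j) ∧
    ∑ j ∈ Finset.range (n + 1), y j < ∑ j ∈ Finset.range (n + 1), t j

theorem sum_consSeq (x : ℝ) (s : ℕ → ℝ) (n : ℕ) :
    ∑ j ∈ Finset.range (n + 1), consSeq x s j = ∑ j ∈ Finset.range n, s j + x := by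
  rw [Finset.sum_range_succ']
  rfl

/-- When the next customer arrives at time `a`, the remaining work `x - a` and his service `s 0` can
be fused into one service, leaving the same problem with one service fewer. -/
theorem servesExactly_consSeq (n : ℕ) (x a : ℝ) (s t : ℕ → ℝ) :
    ServesExactly (n + 1) (consSeq x s) (consSeq a t) ↔
      a ≤ x ∧ ServesExactly n (consSeq (x - a + s 0) fun j => s (j + 1)) t := by
  have hs : ∀ m, ∑ j ∈ Finset.range (m + 1), s j = ∑ j ∈ Finset.range m, s (j + 1) + s 0 :=
    fun m => Finset.sum_range_succ' _ _
  unfold ServesExactly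
  simp only [sum_consSeq]
  constructor
  · rintro ⟨h1, h2⟩
    refine ⟨by simpa using h1 0 (by omega), fun i hi => ?_, ?_⟩
    · have := h1 (i + 1) (by omega)
      rw [hs] at this
      linarith
    · rw [hs] at h2
      linarith
  · rintro ⟨h0, h1, h2⟩
    refine ⟨fun i hi => ?_, ?_⟩
    · cases i with
      | zero => simpa using h0
      | succ i =>
        have := h1 i (by omega)
        rw [hs]
        linarith
    · rw [hs]
      linarith

/-- Extension of a finite sequence by zeros. -/
noncomputable def extendZero {n : ℕ} (t : Fin n → ℝ) : ℕ → ℝ :=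
  fun j => if h : j < n then t ⟨j, h⟩ else 0

theorem extendZero_val {n : ℕ} (t : Fin n → ℝ) (i : Fin n) : extendZero t i = t i := by
  simp [extendZero]

theorem extendZero_cons {n : ℕ} (a : ℝ) (t : Fin n → ℝ) :
    extendZero (Fin.cons a t : Fin (n + 1) → ℝ) = consSeq a (extendZero t) := by
  funext j
  cases j with
  | zero => simp [extendZero, consSeq]
  | succ j =>
    simp only [extendZero, consSeq, Nat.add_lt_add_iff_right]
    split_ifs with h
    · exact Fin.cons_succ (α := fun _ => ℝ) a t ⟨j, h⟩
    · rfl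

theorem extendZero_nonneg {n : ℕ} {t : Fin n → ℝ} (ht : ∀ i, 0 ≤ t i) (j : ℕ) :
    0 ≤ extendZero t j := by
  unfold extendZero
  split_ifs
  exacts [ht _, le_rfl]

theorem measurable_extendZero {n : ℕ} (j : ℕ) :
    Measurable fun t : Fin n → ℝ => extendZero t j := by
  unfold extendZero
  split_ifs
  exacts [measurable_pi_apply _, measurable_const]

theorem measurableSet_servesExactly (n : ℕ) {α : Type*} [MeasurableSpace α] {y t : α → ℕ → ℝ}
    (hy : ∀ j, Measurable fun a => y a j) (ht : ∀ j, Measurable fun a => t a j) :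
    MeasurableSet {a | ServesExactly n (y a) (t a)} := by
  have hsy : ∀ m, Measurable fun a => ∑ j ∈ Finset.range m, y a j := fun m =>
    Finset.measurable_fun_sum _ fun j _ => hy j
  have hst : ∀ m, Measurable fun a => ∑ j ∈ Finset.range m, t a j := fun m =>
    Finset.measurable_fun_sum _ fun j _ => ht j
  have : {a | ∀ i < n, ∑ j ∈ Finset.range (i + 1), t a j ≤ ∑ j ∈ Finset.range (i + 1), y a j} =
      ⋂ i ∈ Set.Iio n, {a | ∑ j ∈ Finset.range (i + 1), t a j ≤ ∑ j ∈ Finset.range (i + 1), y a j} := by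
    ext; simp
  refine MeasurableSet.inter (s₁ := {a | ∀ i < n, ∑ j ∈ Finset.range (i + 1), t a j ≤
    ∑ j ∈ Finset.range (i + 1), y a j}) ?_ (measurableSet_lt (hsy _) (hst _))
  rw [this]
  exact MeasurableSet.biInter (Set.to_countable _) fun i _ => measurableSet_le (hst _) (hsy _)

theorem lintegral_expMeasure {r : ℝ} {f : ℝ → ENNReal} (hf : Measurable f) :
    ∫⁻ a, f a ∂expMeasure r = ∫⁻ a, exponentialPDF r a * f a :=
  lintegral_withDensity_eq_lintegral_mul _ (measurable_exponentialPDFReal r).ennreal_ofReal hf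

theorem expMeasure_Ioi {r x : ℝ} (hr : 0 < r) (hx : 0 ≤ x) :
    expMeasure r (Set.Ioi x) = ENNReal.ofReal (Real.exp (-r * x)) := by
  have := isProbabilityMeasure_expMeasure hr
  have hIic : expMeasure r (Set.Iic x) = ENNReal.ofReal (1 - Real.exp (-(r * x))) := by
    have h := lintegral_exponentialPDF_eq_antiDeriv hr x
    rw [if_pos hx] at h
    rw [← h]
    exact withDensity_apply _ measurableSet_Iic
  rw [← Set.compl_Iic, prob_compl_eq_one_sub measurableSet_Iic, hIic, ← ENNReal.ofReal_one,
    ← ENNReal.ofReal_sub]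
  · ring_nf
  · rw [sub_nonneg, Real.exp_le_one_iff]
    nlinarith

/-- Induction by conditioning on the first inter-arrival time. The last service enters only through
the exponential factor, as nobody arrives during it. -/
theorem pi_expMeasure_servesExactly {lam : ℝ} (hlam : 0 < lam) (n : ℕ) {x : ℝ} (hx : 0 ≤ x)
    {s : ℕ → ℝ} (hs : ∀ j, 0 ≤ s j) :
    Measure.pi (fun _ : Fin (n + 1) => expMeasure lam)
      {t | ServesExactly n (consSeq x s) (extendZero t)} =
    ENNReal.ofReal (lam ^ n * Real.exp (-lam * (x + ∑ j ∈ Finset.range n, s j)) *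
      excursionSum n 0 (consSeq x s)) := by
  have := isProbabilityMeasure_expMeasure hlam
  induction n generalizing x s with
  | zero =>
    have : {t : Fin 1 → ℝ | ServesExactly 0 (consSeq x s) (extendZero t)} =
        Set.univ.pi fun _ => Set.Ioi x := by
      ext t
      simp [ServesExactly, consSeq, extendZero]
    rw [this, Measure.pi_pi]
    simp [expMeasure_Ioi hlam hx, excursionSum]
  | succ n ih =>
    have hmeas : MeasurableSet
        {t : Fin (n + 1 + 1) → ℝ | ServesExactly (n + 1) (consSeq x s) (extendZero t)} :=
      measurableSet_servesExactly _ (fun _ => measurable_const) measurable_extendZero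
    have hpres := (measurePreserving_piFinSuccAbove (fun _ : Fin (n + 1 + 1) => expMeasure lam) 0).symm
    rw [← hpres.measure_preimage hmeas.nullMeasurableSet,
      Measure.prod_apply (hpres.measurable hmeas)]
    have hslice : ∀ a : ℝ, Prod.mk a ⁻¹' ((MeasurableEquiv.piFinSuccAbove
        (fun _ : Fin (n + 1 + 1) => ℝ) 0).symm ⁻¹'
          {t | ServesExactly (n + 1) (consSeq x s) (extendZero t)}) =
        {t : Fin (n + 1) → ℝ | a ≤ x ∧
          ServesExactly n (consSeq (x - a + s 0) fun j => s (j + 1)) (extendZero t)} := by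
      intro a
      ext t
      rw [Set.mem_preimage, Set.mem_preimage, Set.mem_ofPred_eq, Set.mem_ofPred_eq,
        ← servesExactly_consSeq, ← extendZero_cons]
      simp [MeasurableEquiv.piFinSuccAbove_symm_apply, Fin.insertNthEquiv]
    simp only [hslice]
    -- The density factor `e^{-lam a}` combines with the exponential of the shortened workload to a
    -- constant free of `a`; only the polynomial is left to integrate over `[0, x]`.
    set c : ℝ := lam ^ (n + 1) * Real.exp (-lam * (x + ∑ j ∈ Finset.range (n + 1), s j)) with hc
    let g : ℝ → ℝ := fun u => excursionSum n 0 (consSeq (u + s 0) fun j => s (j + 1))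
    have hg : Continuous g := (continuous_excursionSum_consSeq n _).comp (continuous_add_const (s 0))
    have hfun : ∀ a, exponentialPDF lam a * Measure.pi (fun _ : Fin (n + 1) => expMeasure lam)
        {t | a ≤ x ∧ ServesExactly n (consSeq (x - a + s 0) fun j => s (j + 1)) (extendZero t)} =
        (Set.Icc 0 x).indicator (fun a => ENNReal.ofReal (c * g (x - a))) a := by
      intro a
      by_cases ha : a ∈ Set.Icc 0 x
      · rw [Set.indicator_of_mem ha, exponentialPDF_of_nonneg ha.1]
        simp only [ha.2, true_and]
        rw [ih (by linarith [hs 0, ha.2]) (fun j => hs (j + 1)), ← ENNReal.ofReal_mul (by positivity)]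
        congr 1
        rw [hc, Finset.sum_range_succ', show -lam * (x + (∑ j ∈ Finset.range n, s (j + 1) + s 0)) =
          -(lam * a) + -lam * (x - a + s 0 + ∑ j ∈ Finset.range n, s (j + 1)) by ring, Real.exp_add]
        simp only [g]
        ring
      · rw [Set.indicator_of_notMem ha]
        rcases lt_or_ge a 0 with h0 | h0
        · rw [exponentialPDF_of_neg h0, zero_mul]
        · have : ¬ a ≤ x := fun h => ha ⟨h0, h⟩
          simp [this]
    rw [lintegral_expMeasure]
    · rw [lintegral_congr hfun, lintegral_indicator measurableSet_Icc,
        ← ofReal_integral_eq_lintegral_ofReal]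
      · congr 1
        rw [integral_Icc_eq_integral_Ioc, ← intervalIntegral.integral_of_le hx,
          intervalIntegral.integral_const_mul, intervalIntegral.integral_comp_sub_left (fun u => g u),
          sub_self, sub_zero, integral_excursionSum]
      · exact (by fun_prop : Continuous fun a => c * g (x - a)).integrableOn_Icc
      · refine (ae_restrict_iff' measurableSet_Icc).2 (Filter.Eventually.of_forall fun a ha => ?_)
        refine mul_nonneg (by positivity) (excursionSum_nonneg _ _ fun j => ?_)
        cases j with
        | zero => exact add_nonneg (sub_nonneg.2 ha.2) (hs 0)
        | succ j => exact hs (j + 1)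
    · simp only [← hslice]
      exact measurable_measure_prodMk_left (hpres.measurable hmeas)

/-! ### Product densities -/

theorem lintegral_pi_prod {n : ℕ} (μ : Fin n → Measure ℝ) [∀ i, SigmaFinite (μ i)]
    {f : Fin n → ℝ → ENNReal} (hf : ∀ i, Measurable (f i)) :
    ∫⁻ x, ∏ i, f i (x i) ∂Measure.pi μ = ∏ i, ∫⁻ x, f i x ∂μ i := by
  induction n with
  | zero => simp
  | succ n ih =>
    rw [← (measurePreserving_piFinSuccAbove μ 0).symm.lintegral_comp_emb
      (MeasurableEquiv.measurableEmbedding _)]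
    simp_rw [MeasurableEquiv.piFinSuccAbove_symm_apply, Fin.insertNthEquiv, Fin.prod_univ_succ,
      Equiv.coe_fn_mk, Fin.insertNth_zero, Fin.cons_succ, Fin.cons_zero]
    simp only [Fin.zero_succAbove, cast_eq]
    rw [lintegral_prod_mul (f := f 0) (g := fun x : Fin n → ℝ => ∏ i, f i.succ (x i)) (hf 0).aemeasurable
      (Finset.measurable_fun_prod _ fun i _ => (hf _).comp (measurable_pi_apply i)).aemeasurable]
    congr 1
    exact ih (fun i => μ i.succ) fun i => hf i.succ

theorem pi_withDensity {n : ℕ} (μ : Fin n → Measure ℝ) [∀ i, SigmaFinite (μ i)]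
    {f : Fin n → ℝ → ENNReal} (hf : ∀ i, Measurable (f i))
    [∀ i, SigmaFinite ((μ i).withDensity (f i))] :
    Measure.pi (fun i => (μ i).withDensity (f i)) =
      (Measure.pi μ).withDensity fun x => ∏ i, f i (x i) := by
  refine Measure.pi_eq fun s hs => ?_
  rw [withDensity_apply _ (MeasurableSet.univ_pi hs), Measure.restrict_pi_pi,
    lintegral_pi_prod _ hf]
  exact Finset.prod_congr rfl fun i _ => (withDensity_apply _ (hs i)).symm

theorem gammaPDFReal_natCast_add_one {r x : ℝ} (hx : 0 ≤ x) (m : ℕ) :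
    gammaPDFReal (m + 1) r x =
      r ^ (m + 1) * Real.exp (-r * x) * (x ^ m / (m.factorial : ℝ)) := by
  rw [gammaPDFReal, if_pos hx, Real.Gamma_nat_eq_factorial, add_sub_cancel_right,
    Real.rpow_natCast, ← Nat.cast_add_one, Real.rpow_natCast, neg_mul]
  ring

/-- The shape parameters of the service times, given a Dyck path. -/
def blockShape (n : ℕ) (p : DyckWord) : Fin (n + 1) → ℕ :=
  Fin.snoc (α := fun _ => ℕ) (fun i : Fin n => alpha p i) 0

/-- The service density is a mixture of products of Gamma densities. -/
theorem serviceDensity_eq_sum_gammaPDFReal {lam mu : ℝ} (n : ℕ) (y : Fin (n + 1) → ℝ) :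
    serviceDensity lam mu n y = (catalan n : ℝ)⁻¹ * ∑ p : {p : DyckWord // p.semilength = n},
      ∏ i, gammaPDFReal (blockShape n p.1 i + 1) (lam + mu) (y i) := by
  unfold serviceDensity
  by_cases hy : ∀ i, 0 ≤ y i
  · rw [Set.indicator_of_mem (by exact hy), dyckPoly, div_eq_inv_mul]
    simp only [mul_assoc, Finset.mul_sum, Finset.sum_mul]
    refine Finset.sum_congr rfl fun p _ => ?_
    congr 1
    rw [Finset.prod_congr rfl fun i _ => gammaPDFReal_natCast_add_one (hy i) _,
      Fin.prod_univ_castSucc, Finset.prod_mul_distrib, Finset.prod_mul_distrib,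
      Finset.prod_pow_eq_pow_sum]
    simp only [blockShape, Fin.snoc_castSucc, Fin.snoc_last]
    -- The shape parameters add up to `n + (n + 1) = 2 n + 1`.
    rw [Finset.sum_add_distrib, sum_alpha p.2, ← Real.exp_sum, ← Finset.mul_sum]
    simp
    ring
  · rw [Set.indicator_of_notMem (by exact hy)]
    push Not at hy
    obtain ⟨i, hi⟩ := hy
    rw [Finset.sum_eq_zero, mul_zero]
    intro p _
    refine Finset.prod_eq_zero (Finset.mem_univ i) ?_
    rw [gammaPDFReal, if_neg (not_le.2 hi)]

theorem catalan_pos (n : ℕ) : 0 < catalan n := by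
  rw [catalan_eq_centralBinom_div]
  exact Nat.div_pos (Nat.le_of_dvd (Nat.centralBinom_pos n) (Nat.succ_dvd_centralBinom n))
    (Nat.succ_pos n)

theorem measurable_serviceDensity {lam mu : ℝ} (n : ℕ) : Measurable (serviceDensity lam mu n) := by
  rw [funext (serviceDensity_eq_sum_gammaPDFReal (lam := lam) (mu := mu) n)]
  refine Measurable.const_mul (Finset.measurable_fun_sum _ fun p _ =>
    Finset.measurable_fun_prod _ fun i _ => ?_) _
  exact (measurable_gammaPDFReal _ _).comp (measurable_pi_apply i)

/-- Each of the `catalan n` Dyck paths contributes a product of Gamma densities, of mass one. -/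
theorem lintegral_serviceDensity {lam mu : ℝ} (h : 0 < lam + mu) (n : ℕ) :
    ∫⁻ y, ENNReal.ofReal (serviceDensity lam mu n y) = 1 := by
  have hpos : ∀ (p : DyckWord) (y : Fin (n + 1) → ℝ) i,
      0 ≤ gammaPDFReal (blockShape n p i + 1) (lam + mu) (y i) := fun p y i =>
    gammaPDFReal_nonneg (by positivity) h _
  have hcat : (0 : ℝ) < catalan n := by exact_mod_cast catalan_pos n
  have hfun : ∀ y, ENNReal.ofReal (serviceDensity lam mu n y) = (catalan n : ENNReal)⁻¹ *
      ∑ p : {p : DyckWord // p.semilength = n},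
        ∏ i, gammaPDF (blockShape n p.1 i + 1) (lam + mu) (y i) := by
    intro y
    rw [serviceDensity_eq_sum_gammaPDFReal, ENNReal.ofReal_mul (by positivity),
      ENNReal.ofReal_inv_of_pos hcat, ENNReal.ofReal_natCast,
      ENNReal.ofReal_sum_of_nonneg fun p _ => Finset.prod_nonneg fun i _ => hpos _ _ _]
    congr 1
    refine Finset.sum_congr rfl fun p _ => ?_
    rw [ENNReal.ofReal_prod_of_nonneg fun i _ => hpos _ _ _]
    rfl
  have hmeas : ∀ a : ℝ, Measurable (gammaPDF a (lam + mu)) := fun a =>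
    (measurable_gammaPDFReal a (lam + mu)).ennreal_ofReal
  rw [lintegral_congr hfun, lintegral_const_mul, lintegral_finsetSum]
  · have hone : ∀ p : {p : DyckWord // p.semilength = n}, ∫⁻ y : Fin (n + 1) → ℝ,
        ∏ i, gammaPDF (blockShape n p.1 i + 1) (lam + mu) (y i) = 1 := by
      intro p
      rw [volume_pi, lintegral_pi_prod _ fun i => hmeas _]
      exact Finset.prod_eq_one fun i _ => lintegral_gammaPDF_eq_one (by positivity) h
    rw [Finset.sum_congr rfl fun p _ => hone p, Finset.sum_const, Finset.card_univ,
      DyckWord.card_dyckWord_semilength_eq_catalan, nsmul_eq_mul, mul_one]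
    exact ENNReal.inv_mul_cancel (by exact_mod_cast (catalan_pos n).ne') (by simp)
  · exact fun p _ => Finset.measurable_fun_prod _ fun i _ => (hmeas _).comp (measurable_pi_apply i)
  · exact Finset.measurable_fun_sum _ fun p _ =>
      Finset.measurable_fun_prod _ fun i _ => (hmeas _).comp (measurable_pi_apply i)

/-! ### Joint law of the service times and the length of the busy period -/

/-- The probability, in units of the probability that a busy period begins, that a busy period
comprises `n + 1` customers. -/
noncomputable def busyWeight (lam mu : ℝ) (n : ℕ) : ℝ :=
  mu ^ (n + 1) * lam ^ n * catalan n / (lam + mu) ^ (2 * n + 1)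

theorem busyWeight_pos {lam mu : ℝ} (hlam : 0 < lam) (hmu : 0 < mu) (n : ℕ) :
    0 < busyWeight lam mu n := by
  have := catalan_pos n
  unfold busyWeight
  positivity

theorem prod_exponentialPDF_mul_servesExactly {lam mu : ℝ} (hlam : 0 < lam) (hmu : 0 < mu) (n : ℕ)
    (y : Fin (n + 1) → ℝ) :
    (∏ i, exponentialPDF mu (y i)) * Measure.pi (fun _ : Fin (n + 1) => expMeasure lam)
      {t | ServesExactly n (extendZero y) (extendZero t)} =
    ENNReal.ofReal (busyWeight lam mu n) * ENNReal.ofReal (serviceDensity lam mu n y) := by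
  by_cases hy : ∀ i, 0 ≤ y i
  · have hcons : extendZero y = consSeq (y 0) (extendZero (Fin.tail y)) := by
      rw [← extendZero_cons, Fin.cons_self_tail]
    have hsum : y 0 + ∑ j ∈ Finset.range n, extendZero (Fin.tail y) j = ∑ i, y i := by
      rw [← Fin.sum_univ_eq_sum_range, Fin.sum_univ_succ]
      simp only [extendZero_val]
      rfl
    have hpoly : excursionSum n 0 (extendZero y) = dyckPoly n fun i => y i.castSucc := by
      rw [← dyckPoly_eq_excursionSum]
      congr 1
      funext i
      exact extendZero_val y i.castSucc
    rw [hcons, pi_expMeasure_servesExactly hlam n (hy 0)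
        (extendZero_nonneg (t := Fin.tail y) fun i => hy i.succ),
      ← hcons, hsum, hpoly, ← ENNReal.ofReal_mul (busyWeight_pos hlam hmu n).le,
      Finset.prod_congr rfl fun i _ => exponentialPDF_of_nonneg (hy i),
      ← ENNReal.ofReal_prod_of_nonneg fun i _ => by positivity,
      ← ENNReal.ofReal_mul (Finset.prod_nonneg fun i _ => by positivity)]
    congr 1
    rw [serviceDensity, Set.indicator_of_mem (by exact hy), busyWeight, Finset.prod_mul_distrib,
      ← Real.exp_sum, Finset.prod_const, Finset.card_univ, Fintype.card_fin,
      Finset.sum_neg_distrib, ← Finset.mul_sum]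
    have hexp : Real.exp (-(mu * ∑ i, y i)) * Real.exp (-lam * ∑ i, y i) =
        Real.exp (-(lam + mu) * ∑ i : Fin n, y i.castSucc) *
          Real.exp (-(lam + mu) * y (Fin.last n)) := by
      rw [← Real.exp_add, ← Real.exp_add, Fin.sum_univ_castSucc]
      congr 1
      ring
    have hcat : (catalan n : ℝ) ≠ 0 := by exact_mod_cast (catalan_pos n).ne'
    have hne : lam + mu ≠ 0 := by positivity
    have hcancel : ∀ a b d : ℝ, mu ^ (n + 1) * lam ^ n * catalan n / (lam + mu) ^ (2 * n + 1) *
        ((lam + mu) ^ (2 * n + 1) / catalan n * a * d * b) =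
        mu ^ (n + 1) * lam ^ n * d * (a * b) := by
      intro a b d
      field_simp
    rw [hcancel, ← hexp]
    ring
  · rw [serviceDensity, Set.indicator_of_notMem (by exact hy)]
    push Not at hy
    obtain ⟨i, hi⟩ := hy
    rw [Finset.prod_eq_zero (Finset.mem_univ i) (exponentialPDF_of_neg hi)]
    simp

/-- The joint law of service times and of the event that the busy period has `n + 1` customers. -/
theorem prod_pi_expMeasure_servesExactly {lam mu : ℝ} (hlam : 0 < lam) (hmu : 0 < mu) (n : ℕ)
    {S : Set (Fin (n + 1) → ℝ)} (hS : MeasurableSet S) :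
    ((Measure.pi fun _ : Fin (n + 1) => expMeasure mu).prod
      (Measure.pi fun _ : Fin (n + 1) => expMeasure lam))
      {z | z.1 ∈ S ∧ ServesExactly n (extendZero z.1) (extendZero z.2)} =
    ENNReal.ofReal (busyWeight lam mu n) *
      volume.withDensity (fun y => ENNReal.ofReal (serviceDensity lam mu n y)) S := by
  have := isProbabilityMeasure_expMeasure hlam
  have hPmu := isProbabilityMeasure_expMeasure hmu
  have hpdf : Measurable (exponentialPDF mu) := (measurable_exponentialPDFReal mu).ennreal_ofReal
  have hD : Measurable fun y => ENNReal.ofReal (serviceDensity lam mu n y) :=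
    (measurable_serviceDensity n).ennreal_ofReal
  have hG : MeasurableSet {z : (Fin (n + 1) → ℝ) × (Fin (n + 1) → ℝ) |
      ServesExactly n (extendZero z.1) (extendZero z.2)} :=
    measurableSet_servesExactly n (fun j => (measurable_extendZero j).comp measurable_fst)
      fun j => (measurable_extendZero j).comp measurable_snd
  have hmeas : MeasurableSet {z : (Fin (n + 1) → ℝ) × (Fin (n + 1) → ℝ) |
      z.1 ∈ S ∧ ServesExactly n (extendZero z.1) (extendZero z.2)} := (measurable_fst hS).inter hG
  have hexp : Measure.pi (fun _ : Fin (n + 1) => expMeasure mu) =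
      (volume : Measure (Fin (n + 1) → ℝ)).withDensity fun y => ∏ i, exponentialPDF mu (y i) := by
    have : SigmaFinite ((volume : Measure ℝ).withDensity (exponentialPDF mu)) :=
      inferInstanceAs (SigmaFinite (expMeasure mu))
    rw [volume_pi, ← pi_withDensity (fun _ => volume) fun _ => hpdf]
    rfl
  have hprod : Measurable fun y : Fin (n + 1) → ℝ => ∏ i, exponentialPDF mu (y i) :=
    Finset.measurable_fun_prod _ fun i _ => hpdf.comp (measurable_pi_apply i)
  rw [Measure.prod_apply hmeas, withDensity_apply _ hS, hexp,
    lintegral_withDensity_eq_lintegral_mul _ hprod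
      (measurable_measure_prodMk_left hmeas),
    ← lintegral_const_mul _ hD, ← lintegral_indicator hS]
  refine lintegral_congr fun y => ?_
  rw [Pi.mul_apply]
  by_cases hy : y ∈ S
  · rw [Set.indicator_of_mem hy, ← prod_exponentialPDF_mul_servesExactly hlam hmu]
    congr 2
    ext t
    simp [hy]
  · rw [Set.indicator_of_notMem hy]
    have : Prod.mk y ⁻¹' {z : (Fin (n + 1) → ℝ) × (Fin (n + 1) → ℝ) |
      z.1 ∈ S ∧ ServesExactly n (extendZero z.1) (extendZero z.2)} = ∅ := by
      ext t
      simp [hy]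
    rw [this, measure_empty, mul_zero]

/-! ### Workload found by a customer -/

/-- The supremum of the sums `x n + x (n - 1) + ⋯ + x (n - i)`. -/
noncomputable def backwardSup (x : ℤ → ℝ) (n : ℤ) : ℝ :=
  ⨆ i : ℕ, ∑ l ∈ Finset.range (i + 1), x (n - l)

theorem arrival_add_sum_eq (A σ : ℤ → ℝ) (n : ℤ) (i : ℕ) :
    A (n - i) + ∑ j ∈ Finset.Icc (n - i) n, σ j =
      A (n + 1) + ∑ l ∈ Finset.range (i + 1), (σ (n - l) - (A (n - l + 1) - A (n - l))) := by
  induction i with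
  | zero =>
    simp
    ring
  | succ i ih =>
    have hIcc : Finset.Icc (n - (i + 1 : ℕ)) n = insert (n - (i + 1 : ℕ)) (Finset.Icc (n - i) n) := by
      ext j
      simp only [Finset.mem_insert, Finset.mem_Icc]
      omega
    rw [hIcc, Finset.sum_insert (by simp only [Finset.mem_Icc]; omega), Finset.sum_range_succ,
      ← add_assoc (A (n + 1)), ← ih, show n - ((i + 1 : ℕ) : ℤ) + 1 = n - i by push_cast; ring]
    ring

/-- The customers `m ≤ n`, counted backwards. -/
def iicEquivNat (n : ℤ) : ℕ ≃ Set.Iic n where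
  toFun i := ⟨n - i, by simp⟩
  invFun m := (n - m).toNat
  left_inv i := by simp
  right_inv m := by
    have := m.2
    rw [Set.mem_Iic] at this
    ext
    simp [this]

theorem range_departure_eq (A σ : ℤ → ℝ) (n : ℤ) :
    (Set.range fun m : Set.Iic n => A m + ∑ j ∈ Finset.Icc (m : ℤ) n, σ j) =
      Set.range fun i : ℕ => A (n + 1) +
        ∑ l ∈ Finset.range (i + 1), (σ (n - l) - (A (n - l + 1) - A (n - l))) := by
  rw [← (iicEquivNat n).surjective.range_comp]
  congr 1
  funext i
  exact arrival_add_sum_eq A σ n i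

/-- Removes absolute times: whether customer `n + 1` finds the queue empty is the sign of a
functional of the `σ_j, τ_j` with `j ≤ n`. -/
theorem departure_eq_add_backwardSup {A σ : ℤ → ℝ} {n : ℤ}
    (hb : BddAbove (Set.range fun i : ℕ =>
      ∑ l ∈ Finset.range (i + 1), (σ (n - l) - (A (n - l + 1) - A (n - l))))) :
    departure A σ n = A (n + 1) + backwardSup (fun j => σ j - (A (j + 1) - A j)) n := by
  rw [departure, iSup, range_departure_eq]
  exact ((OrderIso.addLeft (A (n + 1))).map_ciSup hb).symm

theorem bddAbove_departure {A σ : ℤ → ℝ} {n : ℤ}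
    (hb : BddAbove (Set.range fun i : ℕ =>
      ∑ l ∈ Finset.range (i + 1), (σ (n - l) - (A (n - l + 1) - A (n - l))))) :
    BddAbove (Set.range fun m : Set.Iic n => A m + ∑ j ∈ Finset.Icc (m : ℤ) n, σ j) := by
  rw [range_departure_eq]
  obtain ⟨b, hb⟩ := hb
  refine ⟨A (n + 1) + b, ?_⟩
  rintro _ ⟨i, rfl⟩
  exact add_le_add le_rfl (hb ⟨i, rfl⟩)

/-- One half of Lindley's recursion. -/
theorem backwardSup_le {x : ℤ → ℝ} {n : ℤ}
    (hb : BddAbove (Set.range fun i : ℕ => ∑ l ∈ Finset.range (i + 1), x (n - 1 - l))) :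
    backwardSup x n ≤ x n + max 0 (backwardSup x (n - 1)) := by
  refine ciSup_le fun i => ?_
  rw [Finset.sum_range_succ', add_comm]
  have hx : x (n - (0 : ℕ)) = x n := by simp
  rw [hx]
  gcongr
  cases i with
  | zero => simp
  | succ i =>
    refine le_max_of_le_right (le_trans (le_of_eq ?_) (le_ciSup hb i))
    refine Finset.sum_congr rfl fun l _ => ?_
    congr 1
    push_cast
    ring

/-! ### Exponential variables -/

theorem ae_pos_of_hasLaw_expMeasure {Ω : Type*} [MeasurableSpace Ω] {P : Measure Ω} {r : ℝ}
    (hr : 0 < r) {X : Ω → ℝ} (hX : HasLaw X (expMeasure r) P) : ∀ᵐ ω ∂P, 0 < X ω := by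
  have := isProbabilityMeasure_expMeasure hr
  have h : ∀ᵐ x ∂expMeasure r, x ∈ Set.Ioi (0 : ℝ) :=
    (mem_ae_iff_prob_eq_one measurableSet_Ioi).2 (by simp [expMeasure_Ioi hr le_rfl])
  rw [← hX.map_eq] at h
  exact ae_of_ae_map hX.aemeasurable h

theorem lintegral_ofReal_abs_expMeasure {r : ℝ} (hr : 0 < r) :
    ∫⁻ x, ENNReal.ofReal |x| ∂expMeasure r = ENNReal.ofReal r⁻¹ := by
  have hmeas : Measurable (gammaPDF ((1 : ℕ) + 1) r) :=
    (measurable_gammaPDFReal _ r).ennreal_ofReal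
  have hfun : ∀ x, exponentialPDF r x * ENNReal.ofReal |x| =
      ENNReal.ofReal r⁻¹ * gammaPDF ((1 : ℕ) + 1) r x := by
    intro x
    rcases lt_or_ge x 0 with hx | hx
    · rw [exponentialPDF_of_neg hx, gammaPDF_of_neg hx, zero_mul, mul_zero]
    · rw [exponentialPDF_of_nonneg hx, gammaPDF, gammaPDFReal_natCast_add_one hx,
        ← ENNReal.ofReal_mul (by positivity), ← ENNReal.ofReal_mul (by positivity), abs_of_nonneg hx]
      congr 1
      simp
      field_simp
  rw [lintegral_expMeasure (by fun_prop), lintegral_congr hfun, lintegral_const_mul _ hmeas,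
    lintegral_gammaPDF_eq_one (by positivity) hr, mul_one]

theorem integrable_of_hasLaw_expMeasure {Ω : Type*} [MeasurableSpace Ω] {P : Measure Ω} {r : ℝ}
    (hr : 0 < r) {X : Ω → ℝ} (hX : HasLaw X (expMeasure r) P) : Integrable X P := by
  have h : Integrable id (expMeasure r) := by
    refine ⟨aestronglyMeasurable_id, ?_⟩
    simp only [HasFiniteIntegral, id, Real.enorm_eq_ofReal_abs]
    rw [lintegral_ofReal_abs_expMeasure hr]
    exact ENNReal.ofReal_lt_top
  rw [← hX.map_eq] at h
  exact h.comp_aemeasurable hX.aemeasurable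

theorem integral_of_hasLaw_expMeasure {Ω : Type*} [MeasurableSpace Ω] {P : Measure Ω} {r : ℝ}
    (hr : 0 < r) {X : Ω → ℝ} (hX : HasLaw X (expMeasure r) P) : ∫ ω, X ω ∂P = r⁻¹ := by
  have hpos := ae_pos_of_hasLaw_expMeasure hr hX
  rw [integral_eq_lintegral_of_nonneg_ae (hpos.mono fun ω h => h.le)
    hX.aemeasurable.aestronglyMeasurable]
  have : ∫⁻ ω, ENNReal.ofReal (X ω) ∂P = ∫⁻ ω, ENNReal.ofReal |X ω| ∂P :=
    lintegral_congr_ae (hpos.mono fun ω h => by simp only [abs_of_pos h])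
  rw [this, ← lintegral_map' (f := fun x => ENNReal.ofReal |x|) (by fun_prop) hX.aemeasurable,
    hX.map_eq, lintegral_ofReal_abs_expMeasure hr, ENNReal.toReal_ofReal (by positivity)]

/-- A random walk whose increments are differences of exponential variables, with negative drift,
is bounded above. -/
theorem ae_bddAbove_sum_sub {Ω : Type*} [MeasurableSpace Ω] {P : Measure Ω}
    {lam mu : ℝ} (hlam : 0 < lam) (hstable : lam < mu) {S T : ℕ → Ω → ℝ}
    (hS : ∀ i, HasLaw (S i) (expMeasure mu) P) (hT : ∀ i, HasLaw (T i) (expMeasure lam) P)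
    (hSi : Pairwise fun i j => IndepFun (S i) (S j) P)
    (hTi : Pairwise fun i j => IndepFun (T i) (T j) P) :
    ∀ᵐ ω ∂P, BddAbove (Set.range fun i : ℕ =>
      ∑ l ∈ Finset.range (i + 1), (S l ω - T l ω)) := by
  have hmu : 0 < mu := hlam.trans hstable
  have h1 := strong_law_ae_real S (integrable_of_hasLaw_expMeasure hmu (hS 0)) hSi
    fun i => ⟨(hS i).aemeasurable, (hS 0).aemeasurable, by rw [(hS i).map_eq, (hS 0).map_eq]⟩
  have h2 := strong_law_ae_real T (integrable_of_hasLaw_expMeasure hlam (hT 0)) hTi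
    fun i => ⟨(hT i).aemeasurable, (hT 0).aemeasurable, by rw [(hT i).map_eq, (hT 0).map_eq]⟩
  rw [integral_of_hasLaw_expMeasure hmu (hS 0)] at h1
  rw [integral_of_hasLaw_expMeasure hlam (hT 0)] at h2
  filter_upwards [h1, h2] with ω h1 h2
  have h3 := (h1.sub h2).comp (Filter.tendsto_add_atTop_nat 1)
  -- The mean increment is negative, so the sums are eventually negative and their range is bounded
  -- above.
  have hneg : mu⁻¹ - lam⁻¹ < 0 := sub_neg.2 ((inv_lt_inv₀ hmu hlam).2 hstable)
  refine Filter.IsBoundedUnder.bddAbove_range ⟨0, ?_⟩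
  rw [Filter.eventually_map]
  filter_upwards [h3.eventually_lt_const hneg] with i hi
  rw [Finset.sum_sub_distrib]
  simp only [Function.comp, ← sub_div] at hi
  have hi1 : (0 : ℝ) < ((i + 1 : ℕ) : ℝ) := by positivity
  have := (div_lt_iff₀ hi1).1 hi
  linarith

/-- Variables that are functions of disjoint subfamilies of an independent family are
independent. -/
theorem indepFun_of_disjoint {Ω ι β γ : Type*} [MeasurableSpace Ω] [MeasurableSpace β]
    [MeasurableSpace γ] {P : Measure Ω} {f : ι → Ω → ℝ} (hf : ∀ i, Measurable (f i))
    (hind : iIndepFun f P) {S T : Set ι} (hST : Disjoint S T) {X : Ω → β} {Y : Ω → γ}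
    (hX : ∀ m : MeasurableSpace Ω, (∀ i ∈ S, Measurable[m] (f i)) → Measurable[m] X)
    (hY : ∀ m : MeasurableSpace Ω, (∀ i ∈ T, Measurable[m] (f i)) → Measurable[m] Y) :
    IndepFun X Y P := by
  rw [IndepFun_iff_Indep]
  have := indep_iSup_of_disjoint (fun i => (hf i).comap_le) hind.iIndep hST
  -- The hypotheses `hX`, `hY` are used with the σ-algebras generated by the `f i` with `i ∈ S` and
  -- with `i ∈ T`.
  refine indep_of_indep_of_le_left (indep_of_indep_of_le_right this (hY _ fun i hi => ?_).comap_le)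
    (hX _ fun i hi => ?_).comap_le <;>
  exact Measurable.of_comap_le (le_iSup₂_of_le i hi le_rfl)

theorem measurable_backwardSup {Ω : Type*} [MeasurableSpace Ω] {x : ℤ → Ω → ℝ} {n : ℤ}
    (hx : ∀ j ≤ n, Measurable (x j)) : Measurable fun ω => backwardSup (fun j => x j ω) n :=
  Measurable.iSup fun _ => Finset.measurable_fun_sum _ fun l _ => hx _ (by omega)

theorem servesExactly_congr {n : ℕ} {y y' t t' : ℕ → ℝ} (hy : ∀ j < n + 1, y j = y' j)
    (ht : ∀ j < n + 1, t j = t' j) : ServesExactly n y t ↔ ServesExactly n y' t' := by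
  have hsum : ∀ {u u' : ℕ → ℝ}, (∀ j < n + 1, u j = u' j) → ∀ m ≤ n,
      ∑ j ∈ Finset.range (m + 1), u j = ∑ j ∈ Finset.range (m + 1), u' j := fun hu m hm =>
    Finset.sum_congr rfl fun j hj => hu j (by have := Finset.mem_range.1 hj; omega)
  unfold ServesExactly
  refine and_congr (forall₂_congr fun i hi => ?_) ?_
  · rw [hsum hy i hi.le, hsum ht i hi.le]
  · rw [hsum hy n le_rfl, hsum ht n le_rfl]

/-! ### The queue in equilibrium -/

section Equilibrium

variable {Ω : Type*} [MeasurableSpace Ω] {P : Measure Ω} {lam mu : ℝ} {A σ : ℤ → Ω → ℝ}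

theorem measurable_sumElim (hA : ∀ k, Measurable (A k)) (hσ : ∀ k, Measurable (σ k)) (i : ℤ ⊕ ℤ) :
    Measurable (Sum.elim (fun (k : ℤ) (ω : Ω) => A (k + 1) ω - A k ω) σ i) := by
  rcases i with k | k
  exacts [(hA _).sub (hA _), hσ k]

theorem ae_bddAbove_backward (hlam : 0 < lam) (hstable : lam < mu)
    (hτ_law : ∀ k, HasLaw (fun ω => A (k + 1) ω - A k ω) (expMeasure lam) P)
    (hσ_law : ∀ k, HasLaw (σ k) (expMeasure mu) P)
    (hindep : iIndepFun (Sum.elim (fun (k : ℤ) (ω : Ω) => A (k + 1) ω - A k ω) σ) P) :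
    ∀ᵐ ω ∂P, ∀ n : ℤ, BddAbove (Set.range fun i : ℕ =>
      ∑ l ∈ Finset.range (i + 1), (σ (n - l) ω - (A (n - l + 1) ω - A (n - l) ω))) := by
  refine ae_all_iff.2 fun n => ?_
  exact ae_bddAbove_sum_sub hlam hstable (S := fun l => σ (n - l))
    (T := fun l ω => A (n - l + 1) ω - A (n - l) ω) (fun l => hσ_law _) (fun l => hτ_law _)
    (fun i j hij => hindep.indepFun (i := Sum.inr (n - i)) (j := Sum.inr (n - j))
      (by simpa using hij))
    (fun i j hij => hindep.indepFun (i := Sum.inl (n - i)) (j := Sum.inl (n - j))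
      (by simpa using hij))

theorem ae_isRegular (hlam : 0 < lam) (hstable : lam < mu)
    (hτ_law : ∀ k, HasLaw (fun ω => A (k + 1) ω - A k ω) (expMeasure lam) P)
    (hσ_law : ∀ k, HasLaw (σ k) (expMeasure mu) P)
    (hindep : iIndepFun (Sum.elim (fun (k : ℤ) (ω : Ω) => A (k + 1) ω - A k ω) σ) P) :
    ∀ᵐ ω ∂P, IsRegular (fun j => A j ω) (fun j => σ j ω) := by
  have hτ : ∀ᵐ ω ∂P, ∀ k, 0 < A (k + 1) ω - A k ω :=
    ae_all_iff.2 fun k => ae_pos_of_hasLaw_expMeasure hlam (hτ_law k)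
  have hs : ∀ᵐ ω ∂P, ∀ k, 0 < σ k ω :=
    ae_all_iff.2 fun k => ae_pos_of_hasLaw_expMeasure (hlam.trans hstable) (hσ_law k)
  filter_upwards [ae_bddAbove_backward hlam hstable hτ_law hσ_law hindep, hτ, hs] with ω h1 h2 h3
  exact ⟨fun j => sub_pos.1 (h2 j), h3, fun n =>
    bddAbove_departure (A := fun j => A j ω) (σ := fun j => σ j ω) (h1 n)⟩

/-- With positive probability a customer finds the queue empty. -/
theorem measure_backwardSup_neg_ne_zero [IsProbabilityMeasure P]
    (hlam : 0 < lam) (hstable : lam < mu) (hA : ∀ k, Measurable (A k)) (hσ : ∀ k, Measurable (σ k))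
    (hτ_law : ∀ k, HasLaw (fun ω => A (k + 1) ω - A k ω) (expMeasure lam) P)
    (hσ_law : ∀ k, HasLaw (σ k) (expMeasure mu) P)
    (hindep : iIndepFun (Sum.elim (fun (k : ℤ) (ω : Ω) => A (k + 1) ω - A k ω) σ) P) (n : ℤ) :
    P {ω | backwardSup (fun j => σ j ω - (A (j + 1) ω - A j ω)) n < 0} ≠ 0 := by
  -- By Lindley's bound the supremum is at most `V - τ_n`, where `V` does not involve `τ_n`. Some
  -- level `c` satisfies `V ≤ c` with positive probability, and independently `τ_n > c` has positive
  -- probability.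
  let V : Ω → ℝ := fun ω =>
    max 0 (backwardSup (fun j => σ j ω - (A (j + 1) ω - A j ω)) (n - 1)) + σ n ω
  have hVT : IndepFun V (fun ω => A (n + 1) ω - A n ω) P := by
    refine indepFun_of_disjoint (S := {Sum.inl n}ᶜ) (T := {Sum.inl n}) (measurable_sumElim hA hσ)
      hindep disjoint_compl_left (fun m hm => ?_) fun m hm => hm (Sum.inl n) rfl
    refine Measurable.add (measurable_const.max (measurable_backwardSup fun j hj =>
      Measurable.sub (hm (Sum.inr j) (by simp)) (hm (Sum.inl j) ?_))) (hm (Sum.inr n) (by simp))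
    simp only [Set.mem_compl_iff, Set.mem_singleton_iff, Sum.inl.injEq]
    omega
  obtain ⟨c, hc⟩ : ∃ c : ℕ, P (V ⁻¹' Set.Iic (c : ℝ)) ≠ 0 := by
    by_contra! hall
    have hU : ⋃ c : ℕ, V ⁻¹' Set.Iic (c : ℝ) = Set.univ := Set.eq_univ_of_forall fun ω =>
      Set.mem_iUnion.2 (exists_nat_ge (V ω))
    have := measure_iUnion_null hall
    rw [hU] at this
    simp at this
  have hprod := hVT.measure_inter_preimage_eq_mul (Set.Iic (c : ℝ)) (Set.Ioi (c : ℝ))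
    measurableSet_Iic measurableSet_Ioi
  have hexp : P ((fun ω => A (n + 1) ω - A n ω) ⁻¹' Set.Ioi (c : ℝ)) ≠ 0 := by
    rw [← Measure.map_apply_of_aemeasurable (hτ_law n).aemeasurable measurableSet_Ioi,
      (hτ_law n).map_eq, expMeasure_Ioi hlam (Nat.cast_nonneg c)]
    simp [Real.exp_pos]
  intro hzero
  refine (mul_ne_zero hc hexp) (hprod ▸ measure_mono_null_ae ?_ hzero)
  filter_upwards [ae_bddAbove_backward hlam hstable hτ_law hσ_law hindep] with ω hb hω
  have h1 : V ω ≤ c := hω.1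
  have h2 : (c : ℝ) < A (n + 1) ω - A n ω := hω.2
  have h3 := backwardSup_le (x := fun j => σ j ω - (A (j + 1) ω - A j ω)) (n := n) (hb (n - 1))
  show backwardSup (fun j => σ j ω - (A (j + 1) ω - A j ω)) n < 0
  simp only [V] at h1
  linarith

theorem opensBusyPeriod_iff_backwardSup {a s : ℤ → ℝ} (h : IsRegular a s) {k : ℤ}
    (hb : BddAbove (Set.range fun i : ℕ =>
      ∑ l ∈ Finset.range (i + 1), (s (k - 1 - l) - (a (k - 1 - l + 1) - a (k - 1 - l))))) (n : ℕ) :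
    OpensBusyPeriod a s k (n + 1) ↔ backwardSup (fun j => s j - (a (j + 1) - a j)) (k - 1) < 0 ∧
      ServesExactly n (extendZero fun i : Fin (n + 1) => s (k + (i : ℕ)))
        (extendZero fun i : Fin (n + 1) => a (k + (i : ℕ) + 1) - a (k + (i : ℕ))) := by
  rw [h.opensBusyPeriod_iff_sum, departure_eq_add_backwardSup hb, sub_add_cancel, add_lt_iff_neg_left]
  refine and_congr_right fun _ => ?_
  refine servesExactly_congr (y := fun j => s (k + j)) (t := fun j => a (k + j + 1) - a (k + j))
    (fun j hj => ?_) (fun j hj => ?_)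
  · simp [extendZero, hj]
  · simp [extendZero, hj]

/-- The joint law of the service times of a busy period, on the event that it has `n + 1`
customers. -/
theorem measure_backwardSup_servesExactly [IsProbabilityMeasure P]
    (hlam : 0 < lam) (hmu : 0 < mu) (hA : ∀ k, Measurable (A k)) (hσ : ∀ k, Measurable (σ k))
    (hτ_law : ∀ k, HasLaw (fun ω => A (k + 1) ω - A k ω) (expMeasure lam) P)
    (hσ_law : ∀ k, HasLaw (σ k) (expMeasure mu) P)
    (hindep : iIndepFun (Sum.elim (fun (k : ℤ) (ω : Ω) => A (k + 1) ω - A k ω) σ) P)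
    (k : ℤ) (n : ℕ) {S : Set (Fin (n + 1) → ℝ)} (hS : MeasurableSet S) :
    P {ω | backwardSup (fun j => σ j ω - (A (j + 1) ω - A j ω)) (k - 1) < 0 ∧
      (fun i : Fin (n + 1) => σ (k + (i : ℕ)) ω) ∈ S ∧
      ServesExactly n (extendZero fun i : Fin (n + 1) => σ (k + (i : ℕ)) ω)
        (extendZero fun i : Fin (n + 1) => A (k + (i : ℕ) + 1) ω - A (k + (i : ℕ)) ω)} =
    P {ω | backwardSup (fun j => σ j ω - (A (j + 1) ω - A j ω)) (k - 1) < 0} *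
      (ENNReal.ofReal (busyWeight lam mu n) *
        volume.withDensity (fun y => ENNReal.ofReal (serviceDensity lam mu n y)) S) := by
  have hf := measurable_sumElim hA hσ
  let Y : Ω → Fin (n + 1) → ℝ := fun ω i => σ (k + (i : ℕ)) ω
  let X : Ω → Fin (n + 1) → ℝ := fun ω i => A (k + (i : ℕ) + 1) ω - A (k + (i : ℕ)) ω
  let W : Ω → ℝ := fun ω => backwardSup (fun j => σ j ω - (A (j + 1) ω - A j ω)) (k - 1)
  -- The gap `A k - A (k - 1)` has index `k - 1`, so it belongs to the past.
  let past : Set (ℤ ⊕ ℤ) := {i | Sum.elim id id i < k}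
  have hYX : IndepFun Y X P := by
    refine indepFun_of_disjoint (S := Set.range Sum.inr) (T := Set.range Sum.inl) hf hindep
      Set.isCompl_range_inl_range_inr.symm.disjoint (fun m hm => ?_) fun m hm => ?_
    · exact measurable_pi_lambda _ fun i => hm (Sum.inr (k + (i : ℕ))) ⟨_, rfl⟩
    · exact measurable_pi_lambda _ fun i => hm (Sum.inl (k + (i : ℕ))) ⟨_, rfl⟩
  have hWYX : IndepFun W (fun ω => (Y ω, X ω)) P := by
    refine indepFun_of_disjoint (S := past) (T := pastᶜ) hf hindep disjoint_compl_right
      (fun m hm => ?_) fun m hm => ?_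
    · exact measurable_backwardSup fun j hj => Measurable.sub
        (hm (Sum.inr j) (show j < k by omega)) (hm (Sum.inl j) (show j < k by omega))
    · refine Measurable.prodMk (measurable_pi_lambda _ fun i => ?_)
        (measurable_pi_lambda _ fun i => ?_)
      · exact hm (Sum.inr (k + (i : ℕ))) (show ¬ k + ((i : ℕ) : ℤ) < k by omega)
      · exact hm (Sum.inl (k + (i : ℕ))) (show ¬ k + ((i : ℕ) : ℤ) < k by omega)
  have hYlaw : HasLaw Y (Measure.pi fun _ => expMeasure mu) P :=
    (hindep.precomp (g := fun i : Fin (n + 1) => Sum.inr (k + (i : ℕ))) fun i j hij => by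
      ext; simpa using hij).hasLaw_pi fun i => hσ_law _
  have hXlaw : HasLaw X (Measure.pi fun _ => expMeasure lam) P :=
    (hindep.precomp (g := fun i : Fin (n + 1) => Sum.inl (k + (i : ℕ))) fun i j hij => by
      ext; simpa using hij).hasLaw_pi fun i => hτ_law _
  have hmeas : MeasurableSet {z : (Fin (n + 1) → ℝ) × (Fin (n + 1) → ℝ) |
      z.1 ∈ S ∧ ServesExactly n (extendZero z.1) (extendZero z.2)} :=
    (measurable_fst hS).inter (measurableSet_servesExactly n
      (fun j => (measurable_extendZero j).comp measurable_fst)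
      fun j => (measurable_extendZero j).comp measurable_snd)
  have hprod := hWYX.measure_inter_preimage_eq_mul (Set.Iio 0) _ measurableSet_Iio hmeas
  have hYXm : AEMeasurable (fun ω => (Y ω, X ω)) P := hYlaw.aemeasurable.prodMk hXlaw.aemeasurable
  rw [← Measure.map_apply_of_aemeasurable hYXm hmeas,
    hYX.map_prod_eq_prod_map_map hYlaw.aemeasurable hXlaw.aemeasurable, hYlaw.map_eq, hXlaw.map_eq,
    prod_pi_expMeasure_servesExactly hlam hmu n hS] at hprod
  exact hprod

end Equilibrium

end MM1

theorem theorem1 {Ω : Type*} [MeasurableSpace Ω] (P : Measure Ω) [IsProbabilityMeasure P]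
    (lam mu : ℝ) (hlam : 0 < lam) (hstable : lam < mu)
    -- arrival times and service times
    (A σ : ℤ → Ω → ℝ)
    (hA : ∀ k, Measurable (A k)) (hσ : ∀ k, Measurable (σ k))
    -- inter-arrival times are `Exp(lam)`, service times are `Exp(mu)`, all independent
    (hτ_law : ∀ k, HasLaw (fun ω => A (k + 1) ω - A k ω) (expMeasure lam) P)
    (hσ_law : ∀ k, HasLaw (σ k) (expMeasure mu) P)
    (hindep : iIndepFun (Sum.elim (fun (k : ℤ) (ω : Ω) => A (k + 1) ω - A k ω) σ) P)
    -- the busy period opened by customer `k`, with `n + 1` customers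
    (k : ℤ) (n : ℕ) (E : Set Ω)
    (hE : E = {ω | MM1.OpensBusyPeriod (fun j => A j ω) (fun j => σ j ω) k (n + 1)}) :
    NullMeasurableSet E P ∧ P E ≠ 0 ∧
      HasLaw (fun ω (i : Fin (n + 1)) => σ (k + (i : ℕ)) ω)
        (volume.withDensity fun y => ENNReal.ofReal (MM1.serviceDensity lam mu n y))
        (ProbabilityTheory.cond P E) := by
  have hmu : 0 < mu := hlam.trans hstable
  have hsum : 0 < lam + mu := by positivity
  let Y : Ω → Fin (n + 1) → ℝ := fun ω i => σ (k + (i : ℕ)) ω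
  have hY : Measurable Y := measurable_pi_lambda _ fun i => hσ _
  let W : Ω → ℝ := fun ω => MM1.backwardSup (fun j => σ j ω - (A (j + 1) ω - A j ω)) (k - 1)
  have hW : Measurable W :=
    MM1.measurable_backwardSup fun j _ => (hσ j).sub ((hA (j + 1)).sub (hA j))
  let G : Set Ω := {ω | MM1.ServesExactly n
    (MM1.extendZero fun i : Fin (n + 1) => σ (k + (i : ℕ)) ω)
    (MM1.extendZero fun i : Fin (n + 1) => A (k + (i : ℕ) + 1) ω - A (k + (i : ℕ)) ω)}
  have hG : MeasurableSet G := MM1.measurableSet_servesExactly n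
    (fun j => (MM1.measurable_extendZero j).comp hY)
    (fun j => (MM1.measurable_extendZero j).comp (measurable_pi_lambda
      (fun ω (i : Fin (n + 1)) => A (k + (i : ℕ) + 1) ω - A (k + (i : ℕ)) ω)
      fun i => (hA _).sub (hA _)))
  -- The description of `E` by partial sums is established for regular realisations, hence almost
  -- surely; `E` is therefore only shown to be null-measurable.
  have hEeq : E =ᵐ[P] (W ⁻¹' Set.Iio 0 ∩ G : Set Ω) := by
    rw [hE]
    refine Filter.eventuallyEq_set.2 ?_
    filter_upwards [MM1.ae_isRegular hlam hstable hτ_law hσ_law hindep,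
      MM1.ae_bddAbove_backward hlam hstable hτ_law hσ_law hindep] with ω h1 h2
    exact MM1.opensBusyPeriod_iff_backwardSup h1 (h2 (k - 1)) n
  have hEmeas : NullMeasurableSet E P :=
    ((hW measurableSet_Iio).inter hG).nullMeasurableSet.congr hEeq.symm
  have hkey : ∀ S : Set (Fin (n + 1) → ℝ), MeasurableSet S → P (E ∩ Y ⁻¹' S) =
      P (W ⁻¹' Set.Iio 0) * (ENNReal.ofReal (MM1.busyWeight lam mu n) *
        volume.withDensity (fun y => ENNReal.ofReal (MM1.serviceDensity lam mu n y)) S) := by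
    intro S hS
    have h := MM1.measure_backwardSup_servesExactly hlam hmu hA hσ hτ_law hσ_law hindep k n hS
    refine Eq.trans (measure_congr (hEeq.inter (Filter.EventuallyEq.refl _ (Y ⁻¹' S)))) (Eq.trans ?_ h)
    congr 1
    ext ω
    exact ⟨fun h => ⟨h.1.1, h.2, h.1.2⟩, fun h => ⟨⟨h.1, h.2.2⟩, h.2.1⟩⟩
  -- Since `D` has mass one, the case `S = univ` identifies the constant in `hkey` as `P E`, which
  -- conditioning divides out.
  have hPE : P E = P (W ⁻¹' Set.Iio 0) * ENNReal.ofReal (MM1.busyWeight lam mu n) := by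
    have h := hkey Set.univ MeasurableSet.univ
    rw [Set.preimage_univ, Set.inter_univ, withDensity_apply _ MeasurableSet.univ,
      Measure.restrict_univ, MM1.lintegral_serviceDensity hsum, mul_one] at h
    exact h
  have hPE0 : P E ≠ 0 := by
    rw [hPE]
    refine mul_ne_zero (MM1.measure_backwardSup_neg_ne_zero hlam hstable hA hσ hτ_law hσ_law hindep
      (k - 1)) ?_
    simpa using MM1.busyWeight_pos hlam hmu n
  refine ⟨hEmeas, hPE0, hY.aemeasurable, ?_⟩
  ext S hS
  rw [Measure.map_apply hY hS, ProbabilityTheory.cond, Measure.smul_apply,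
    Measure.restrict_apply (hY hS), Set.inter_comm, hkey S hS, ← mul_assoc, ← hPE, smul_eq_mul,
    ← mul_assoc, ENNReal.inv_mul_cancel hPE0 (measure_ne_top P E), one_mul]
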